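/- Theorem 3.1 (Infinitesimal deformations of the Fubini–Study metric). Let $m,n\ge 2$ and let $\gamma$ be a trace-free Hermitian $(n+m)\times(n+m)$ matrix, with sesquilinear form $P_\gamma(v_1,v_2)=v_2^*\gamma v_1$ on $\mathbb C^{n+m}$. Let $\mathcal U$ be the tautological bundle of the Grassmannian $G_m(\mathbb C^{n+m})$ of $m$-planes in $\mathbb C^{n+m}$, let $\mathcal U^\perp$ be its orthogonal complement for the standard Hermitian metric, and identify the holomorphic tangent bundle with $\mathrm{Hom}(\mathcal U,\mathcal U^\perp)=\mathcal U^*\otimes\mathcal U^\perp$. A Hermitian vector space $S$ with a sesquilinear form $P$ carries the dual form $P^*(\alpha,\beta)=P(\beta^\sharp,\alpha^\sharp)$ on $S^*$, where $\alpha=\langle\cdot,\alpha^\sharp\rangle$; and forms $P_1$ on $\mathcal U^*$ and $P_2$ on $\mathcal U^\perp$ have a product $P_1\cdot P_2$ on $\mathcal U^*\otimes\mathcal U^\perp$, determined by $(P_1\cdot P_2)(\alpha\otimes u,\beta\otimes v)=P_1(\alpha,\beta)P_2(u,v)$. Let $g_1,g_2$ be the forms on $\mathcal U^*$ and $\mathcal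 U^\perp$ induced by the standard Hermitian metric, and $H_1,H_2$ those induced by $P_\gamma$. The Fubini–Study metric is $g=g_1\cdot g_2$; put $$h_1=g_1\cdot H_2,\qquad h_2=H_1\cdot g_2,\qquad h_3=f_\gamma\, g,$$ where $f_\gamma(U)=\sum_{i=1}^m P_\gamma(\eta_i,\eta_i)$ for any orthonormal basis $(\eta_i)$ of $U$. A Hermitian form $h=(h_{I\bar J})$ on the holomorphic tangent bundle is identified with the real symmetric tensor whose complex bilinear extension has the components $h_{I\bar J}$, that is, with $2\,\mathrm{Re}\,h$, and has the associated $(1,1)$-form $\sigma=\sqrt{-1}\,h_{I\bar J}\,dw_I\wedge d\bar w_J$. Then $g$ is an Einstein metric with $\mathrm{Ric}(g)=(n+m)g$, and $$\mathcal D_\gamma=n(1-m^2)h_1+m(1-n^2)h_2+(n^2-m^2)h_3$$ is an infinitesimal Einstein deformation of $g$: it is a smooth symmetric 2-tensor with $\mathrm{tr}_g(\mathcal D_\gamma)=0$, $\mathrm{div}(\mathcal D_\gamma)=0$ and $\Delta\mathcal D_\gamma+2\,\mathrm{Rm}(\mathcal D_\gamma)=0$, where $\Delta=\mathrm{tr}_g\nabla^2$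 is the connection Laplacian and $\mathrm{Rm}(h)(X,Y)=\sum_i h(R(e_i,X)Y,e_i)$ over a $g$-orthonormal frame, so that $\mathrm{Rm}(g)=\mathrm{Ric}(g)$. Moreover, its associated $(1,1)$-form $\sigma$ satisfies $\Lambda(\sigma)=0$, $\bar\partial^*\sigma=0$ and $\Delta_{\bar\partial}\sigma=(n+m)\sigma$, where $\Lambda$ is the adjoint of the Lefschetz operator and $\Delta_{\bar\partial}=\bar\partial\bar\partial^*+\bar\partial^*\bar\partial$. -/

import Mathlib

open scoped ContDiff Matrix ComplexConjugate

noncomputable section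

namespace GrassmannEID

/-! ### Riemannian geometry in real coordinates

A metric, or a symmetric 2-tensor, on a coordinate domain is given by its component matrix
as a function of the coordinates `x : ι → ℝ`. -/

/-- The partial derivative `∂f/∂x_a`. -/
def pd {ι F : Type*} [Fintype ι] [DecidableEq ι] [NormedAddCommGroup F] [NormedSpace ℝ F]
    (a : ι) (f : (ι → ℝ) → F) (x : ι → ℝ) : F :=
  fderiv ℝ f x (Pi.single a 1)

section Riemannian

variable {ι : Type*} [Fintype ι] [DecidableEq ι]

/-- `Γ^c_{ab} = ½ g^{cd} (∂_a g_{bd} + ∂_b g_{ad} - ∂_d g_{ab})`. -/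
def christoffel (g : (ι → ℝ) → Matrix ι ι ℝ) (c a b : ι) (x : ι → ℝ) : ℝ :=
  ∑ d, (g x)⁻¹ c d *
    (pd a (fun y => g y b d) x + pd b (fun y => g y a d) x - pd d (fun y => g y a b) x) / 2

/-- `R^d_{cab}`, where `R(∂_a, ∂_b) ∂_c = R^d_{cab} ∂_d` and
`R(X, Y) = ∇_X ∇_Y - ∇_Y ∇_X - ∇_{[X, Y]}`. -/
def riemann (g : (ι → ℝ) → Matrix ι ι ℝ) (d c a b : ι) (x : ι → ℝ) : ℝ :=
  pd a (christoffel g d b c) x - pd b (christoffel g d a c) x +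
    ∑ e, (christoffel g d a e x * christoffel g e b c x -
      christoffel g d b e x * christoffel g e a c x)

/-- `Ric_{bc} = R^a_{cab}`. -/
def ricci (g : (ι → ℝ) → Matrix ι ι ℝ) (b c : ι) (x : ι → ℝ) : ℝ :=
  ∑ a, riemann g a c a b x

/-- `∇_a h_{bc}` for the Levi-Civita connection. -/
def nabla (g h : (ι → ℝ) → Matrix ι ι ℝ) (a b c : ι) (x : ι → ℝ) : ℝ :=
  pd a (fun y => h y b c) x -
    ∑ d, (christoffel g d a b x * h x d c + christoffel g d a c x * h x b d)

/-- `∇_e ∇_a h_{bc}`, the components of the second covariant derivative. -/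
def nabla2 (g h : (ι → ℝ) → Matrix ι ι ℝ) (e a b c : ι) (x : ι → ℝ) : ℝ :=
  pd e (nabla g h a b c) x -
    ∑ d, (christoffel g d e a x * nabla g h d b c x +
      christoffel g d e b x * nabla g h a d c x +
      christoffel g d e c x * nabla g h a b d x)

/-- `tr_g h = g^{ab} h_{ab}`. -/
def traceTensor (g h : (ι → ℝ) → Matrix ι ι ℝ) (x : ι → ℝ) : ℝ :=
  ∑ a, ∑ b, (g x)⁻¹ a b * h x a b

/-- `div(h)_c = g^{ab} ∇_a h_{bc}`. -/
def divTensor (g h : (ι → ℝ) → Matrix ι ι ℝ) (c : ι) (x : ι → ℝ) : ℝ :=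
  ∑ a, ∑ b, (g x)⁻¹ a b * nabla g h a b c x

/-- The connection Laplacian `(Δh)_{bc} = g^{ea} ∇_e ∇_a h_{bc}`. -/
def connLaplacian (g h : (ι → ℝ) → Matrix ι ι ℝ) (b c : ι) (x : ι → ℝ) : ℝ :=
  ∑ e, ∑ a, (g x)⁻¹ e a * nabla2 g h e a b c x

/-- The curvature operator on symmetric 2-tensors, `Rm(h)(X, Y) = ∑ h(R(e_i, X) Y, e_i)` over an
orthonormal frame, so that `Rm(g) = Ric(g)`. -/
def curvOp (g h : (ι → ℝ) → Matrix ι ι ℝ) (b c : ι) (x : ι → ℝ) : ℝ :=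
  ∑ a, ∑ e, (g x)⁻¹ a e * ∑ d, riemann g d c a b x * h x d e

end Riemannian

/-! ### Kähler geometry in holomorphic coordinates

The holomorphic coordinates are `w_I = x (I, 0) + √-1 x (I, 1)`, `I : K`. A Kähler metric is given
by its components `g_{IJ̄}`. A (1,0)-form `∑ β_I dw_I`, a (1,1)-form `∑ s_{IJ} dw_I ∧ dw̄_J` and a
(1,2)-form `∑ T_{KIJ} dw̄_K ∧ dw_I ∧ dw̄_J` (`T` need not be skew in `K, J`) are given by
their coefficients. -/

section Kahler

variable {K : Type*} [Fintype K] [DecidableEq K]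

/-- `∂f/∂w_I`. -/
def dw (I : K) (f : (K × Fin 2 → ℝ) → ℂ) (x : K × Fin 2 → ℝ) : ℂ :=
  (pd (I, 0) f x - Complex.I * pd (I, 1) f x) / 2

/-- `∂f/∂w̄_I`. -/
def dwbar (I : K) (f : (K × Fin 2 → ℝ) → ℂ) (x : K × Fin 2 → ℝ) : ℂ :=
  (pd (I, 0) f x + Complex.I * pd (I, 1) f x) / 2

/-- The inverse metric `g^{IJ̄}`, normalised by `∑_K g^{IK̄} g_{JK̄} = δ_{IJ}`. -/
def invMetric (g : (K × Fin 2 → ℝ) → Matrix K K ℂ) (I J : K) (x : K × Fin 2 → ℝ) : ℂ :=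
  (g x)⁻¹ J I

/-- `Γ^P_{KI} = g^{PQ̄} ∂_K g_{IQ̄}`. -/
def chern (g : (K × Fin 2 → ℝ) → Matrix K K ℂ) (P L I : K) (x : K × Fin 2 → ℝ) : ℂ :=
  ∑ Q, invMetric g P Q x * dw L (fun y => g y I Q) x

/-- `Λσ = -√-1 g^{IJ̄} s_{IJ}`, the adjoint of the Lefschetz operator, i.e. of the exterior product
with `ω = √-1 g_{IJ̄} dw_I ∧ dw̄_J`. -/
def lefschetzAdj (g : (K × Fin 2 → ℝ) → Matrix K K ℂ) (s : K → K → (K × Fin 2 → ℝ) → ℂ)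
    (x : K × Fin 2 → ℝ) : ℂ :=
  -Complex.I * ∑ I, ∑ J, invMetric g I J x * s I J x

/-- `∂̄β` for a (1,0)-form: `∂̄(β_I dw_I) = -∂_J̄ β_I dw_I ∧ dw̄_J`. -/
def dbar10 (β : K → (K × Fin 2 → ℝ) → ℂ) (I J : K) (x : K × Fin 2 → ℝ) : ℂ :=
  -dwbar J (β I) x

/-- `∂̄σ` for a (1,1)-form: `∂̄(s_{IJ} dw_I ∧ dw̄_J) = ∂_K̄ s_{IJ} dw̄_K ∧ dw_I ∧ dw̄_J`. -/
def dbar11 (s : K → K → (K × Fin 2 → ℝ) → ℂ) (L I J : K) (x : K × Fin 2 → ℝ) : ℂ :=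
  dwbar L (s I J) x

/-- `∂̄*σ` for a (1,1)-form. On a Kähler manifold the adjoint of `∂̄` is
`∂̄* = -g^{KL̄} ι(∂_L̄) ∇_K`, and `-ι(∂_L̄) (s_{IJ} dw_I ∧ dw̄_J) = s_{IL} dw_I`. -/
def dbarStar11 (g : (K × Fin 2 → ℝ) → Matrix K K ℂ) (s : K → K → (K × Fin 2 → ℝ) → ℂ)
    (I : K) (x : K × Fin 2 → ℝ) : ℂ :=
  ∑ A, ∑ B, invMetric g A B x *
    (dw A (s I B) x - ∑ P, chern g P A I x * s P B x)

/-- `∂̄*T = -g^{KL̄} ι(∂_L̄) ∇_K T` for a (1,2)-form, where `ι(∂_L̄) T` has the coefficients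
`T_{LIJ} - T_{JIL}`. -/
def dbarStar12 (g : (K × Fin 2 → ℝ) → Matrix K K ℂ) (T : K → K → K → (K × Fin 2 → ℝ) → ℂ)
    (I J : K) (x : K × Fin 2 → ℝ) : ℂ :=
  -∑ A, ∑ B, invMetric g A B x *
    ((dw A (T B I J) x - ∑ P, chern g P A I x * T B P J x) -
      (dw A (T J I B) x - ∑ P, chern g P A I x * T J P B x))

/-- `Δ_∂̄ σ = ∂̄ ∂̄* σ + ∂̄* ∂̄ σ` for a (1,1)-form. -/
def dbarLaplacian (g : (K × Fin 2 → ℝ) → Matrix K K ℂ) (s : K → K → (K × Fin 2 → ℝ) → ℂ)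
    (I J : K) (x : K × Fin 2 → ℝ) : ℂ :=
  dbar10 (dbarStar11 g s) I J x + dbarStar12 g (dbar11 s) I J x

end Kahler

/-! ### The Grassmannian and its charts -/

/-- The ambient Hermitian space `ℂ^{n+m} = ℂ^m ⊕ ℂ^n`. -/
abbrev Amb (m n : ℕ) : Type := EuclideanSpace ℂ (Fin m ⊕ Fin n)

/-- The Grassmannian of `m`-planes in `ℂ^{n+m}`. -/
abbrev Gr (m n : ℕ) : Type := {U : Submodule ℂ (Amb m n) // Module.finrank ℂ U = m}

/-- The unitary frames of `ℂ^{n+m}`. -/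
abbrev Frame (m n : ℕ) : Type := Matrix.unitaryGroup (Fin m ⊕ Fin n) ℂ

/-- Real coordinates `x` of a chart: the entries of the `n × m` matrix `W` are
`w_{ij} = x ((i, j), 0) + √-1 x ((i, j), 1)`. -/
abbrev Idx (m n : ℕ) : Type := (Fin n × Fin m) × Fin 2

/-- The complex matrix with given real coordinates. -/
def toW {m n : ℕ} (x : Idx m n → ℝ) : Matrix (Fin n) (Fin m) ℂ :=
  Matrix.of fun i j => (x ((i, j), 0) : ℂ) + (x ((i, j), 1) : ℂ) * Complex.I

theorem finrank_plane {m n : ℕ} (A : Frame m n) (W : Matrix (Fin n) (Fin m) ℂ) :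
    Module.finrank ℂ (LinearMap.range
      (Matrix.toEuclideanLin ((A : Matrix (Fin m ⊕ Fin n) (Fin m ⊕ Fin n) ℂ) *
        Matrix.fromRows (1 : Matrix (Fin m) (Fin m) ℂ) W))) = m := by
  have h : (Matrix.fromCols (1 : Matrix (Fin m) (Fin m) ℂ) (0 : Matrix (Fin m) (Fin n) ℂ) *
      (A : Matrix (Fin m ⊕ Fin n) (Fin m ⊕ Fin n) ℂ)ᴴ) *
      ((A : Matrix (Fin m ⊕ Fin n) (Fin m ⊕ Fin n) ℂ) *
        Matrix.fromRows (1 : Matrix (Fin m) (Fin m) ℂ) W) = 1 := by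
    rw [Matrix.mul_assoc, ← Matrix.mul_assoc _ (A.1), ← Matrix.star_eq_conjTranspose,
      Matrix.UnitaryGroup.star_mul_self, Matrix.one_mul, Matrix.fromCols_mul_fromRows]
    simp
  rw [LinearMap.finrank_range_of_inj]
  · simp
  · intro v w hvw
    have h1 := congrArg (fun u => Matrix.mulVec (Matrix.fromCols (1 : Matrix (Fin m) (Fin m) ℂ)
      (0 : Matrix (Fin m) (Fin n) ℂ) * (A : Matrix (Fin m ⊕ Fin n) (Fin m ⊕ Fin n) ℂ)ᴴ)
      (WithLp.ofLp u)) hvw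
    simp only [Matrix.ofLp_toLpLin, Matrix.toLin'_apply, Matrix.mulVec_mulVec, h, Matrix.one_mulVec] at h1
    exact (WithLp.ofLp_injective 2) h1

/-- The chart of the Grassmannian attached to the unitary frame `A`:
`W` is sent to the column space of `A (I; W)`. Its domain is all of `Mat^{n × m}(ℂ)`. -/
def chart {m n : ℕ} (A : Frame m n) (W : Matrix (Fin n) (Fin m) ℂ) : Gr m n :=
  ⟨LinearMap.range (Matrix.toEuclideanLin ((A : Matrix (Fin m ⊕ Fin n) (Fin m ⊕ Fin n) ℂ) *
    Matrix.fromRows (1 : Matrix (Fin m) (Fin m) ℂ) W)), finrank_plane A W⟩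

/-- Every point of the Grassmannian is the centre of such a chart. -/
theorem exists_chart_center {m n : ℕ} (U : Gr m n) : ∃ A : Frame m n, chart A 0 = U := by
  obtain ⟨U, hU⟩ := U
  have hU' : Module.finrank ℂ Uᗮ = n := by
    have := Submodule.finrank_add_finrank_orthogonal U
    simp at this
    omega
  let b := ((stdOrthonormalBasis ℂ U).reindex (finCongr hU))
  let c := ((stdOrthonormalBasis ℂ Uᗮ).reindex (finCongr hU'))
  have hon : Orthonormal ℂ (Sum.elim (fun i => (b i : Amb m n)) (fun j => (c j : Amb m n))) := by
    rw [orthonormal_iff_ite]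
    rintro (i | i) (j | j)
    · simpa using orthonormal_iff_ite.1 b.orthonormal i j
    · simpa using Submodule.inner_right_of_mem_orthogonal (b i).2 (c j).2
    · simpa using Submodule.inner_left_of_mem_orthogonal (b j).2 (c i).2
    · simpa using orthonormal_iff_ite.1 c.orthonormal i j
  let B : OrthonormalBasis (Fin m ⊕ Fin n) ℂ (Amb m n) :=
    OrthonormalBasis.mk hon (by
      rw [LinearIndependent.span_eq_top_of_card_eq_finrank' hon.linearIndependent (by simp)])
  let A : Frame m n := ⟨(EuclideanSpace.basisFun (Fin m ⊕ Fin n) ℂ).toBasis.toMatrix B,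
    (EuclideanSpace.basisFun (Fin m ⊕ Fin n) ℂ).toMatrix_orthonormalBasis_mem_unitary B⟩
  have hle : (chart A 0).1 ≤ U := by
    rintro _ ⟨v, rfl⟩
    have hv : Matrix.toEuclideanLin ((A : Matrix (Fin m ⊕ Fin n) (Fin m ⊕ Fin n) ℂ) *
        Matrix.fromRows (1 : Matrix (Fin m) (Fin m) ℂ) 0) v = ∑ i, v i • (b i : Amb m n) := by
      ext k
      have hk : ∀ i, ((A : Matrix (Fin m ⊕ Fin n) (Fin m ⊕ Fin n) ℂ) *
          Matrix.fromRows (1 : Matrix (Fin m) (Fin m) ℂ)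
          (0 : Matrix (Fin n) (Fin m) ℂ)) k i = (b i : Amb m n) k := fun i => by
        simp [A, B, Matrix.mul_apply, Module.Basis.toMatrix_apply, Matrix.one_apply]
      simp only [Matrix.ofLp_toLpLin, Matrix.toLin'_apply, Matrix.mulVec, dotProduct,
        WithLp.ofLp_sum, WithLp.ofLp_smul, Finset.sum_apply, Pi.smul_apply, smul_eq_mul]
      exact Finset.sum_congr rfl fun i _ => by rw [mul_comm, ← hk i]; rfl
    refine hv ▸ ?_
    exact U.sum_mem fun i _ => U.smul_mem _ (b i).2
  refine ⟨A, Subtype.ext (Submodule.eq_of_le_of_finrank_eq hle ?_)⟩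
  rw [(chart A 0).2, hU]

/-- The holomorphic tangent space `Hom(U, U^⊥)` of the Grassmannian at `U`. -/
abbrev Tang {m n : ℕ} (U : Gr m n) : Type := U.1 →ₗ[ℂ] (U.1)ᗮ

/-- The tangent vector in `Hom(U, U^⊥)` of the curve `t ↦ chart A (W + tX)` at `t = 0`,
`U = chart A W`: a vector `v = A (I; W) z` of `U` is sent to the `U^⊥`-component of
`d/dt A (I; W + tX) z = A (0; X) z`. As `z` is the upper block of `A⁻¹ v`, this is the
`U^⊥`-component of `A [[0, 0], [X, 0]] A⁻¹ v`. -/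
def velocity {m n : ℕ} (A : Frame m n) (W X : Matrix (Fin n) (Fin m) ℂ) : Tang (chart A W) :=
  ((chart A W).1ᗮ.orthogonalProjectionOnto : Amb m n →ₗ[ℂ] ((chart A W).1)ᗮ) ∘ₗ
    Matrix.toEuclideanLin ((A : Matrix (Fin m ⊕ Fin n) (Fin m ⊕ Fin n) ℂ) *
      Matrix.fromBlocks 0 0 X 0 * (A : Matrix (Fin m ⊕ Fin n) (Fin m ⊕ Fin n) ℂ)ᴴ) ∘ₗ
    (chart A W).1.subtype

/-! ### Tensor fields on the Grassmannian -/

/-- Fields of sesquilinear forms on the holomorphic tangent bundle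
(linear in the first and conjugate linear in the second argument). -/
abbrev SesqField (m n : ℕ) : Type := ∀ U : Gr m n, Tang U →ₗ[ℂ] Tang U →ₗ⋆[ℂ] ℂ

/-- Fields of real bilinear forms on the (real) tangent bundle. -/
abbrev RealField (m n : ℕ) : Type := ∀ U : Gr m n, Tang U →ₗ[ℝ] Tang U →ₗ[ℝ] ℝ

/-- The components `h_{IJ̄} = h(∂/∂w_I, ∂/∂w_J)` in the chart of `A`. -/
def SesqField.inChart {m n : ℕ} (h : SesqField m n) (A : Frame m n) (x : Idx m n → ℝ) :
    Matrix (Fin n × Fin m) (Fin n × Fin m) ℂ :=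
  Matrix.of fun I J => h (chart A (toW x))
    (velocity A (toW x) (Matrix.single I.1 I.2 1)) (velocity A (toW x) (Matrix.single J.1 J.2 1))

/-- The components `k(∂/∂x_a, ∂/∂x_b)` in the real coordinates of the chart of `A`. -/
def RealField.inChart {m n : ℕ} (k : RealField m n) (A : Frame m n) (x : Idx m n → ℝ) :
    Matrix (Idx m n) (Idx m n) ℝ :=
  Matrix.of fun a b => k (chart A (toW x))
    (velocity A (toW x) (toW (Pi.single a 1))) (velocity A (toW x) (toW (Pi.single b 1)))

/-- The `J`-invariant real tensor whose complex bilinear extension has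
the components `h_{IJ̄}`: it is `2 Re h`. -/
def SesqField.real {m n : ℕ} (h : SesqField m n) : RealField m n := fun U =>
  LinearMap.mk₂ ℝ (fun θ η => 2 * (h U θ η).re)
    (by intros; simp [mul_add]) (by intro c θ η; simp [mul_left_comm, ← Complex.coe_smul])
    (by intros; simp [mul_add]) (by intro c θ η; simp [mul_left_comm, ← Complex.coe_smul])

/-- The coefficients `√-1 h_{IJ̄}` of the (1,1)-form associated to `h`. -/
def SesqField.form {m n : ℕ} (h : SesqField m n) (A : Frame m n)
    (I J : Fin n × Fin m) (x : Idx m n → ℝ) : ℂ :=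
  Complex.I * h.inChart A x I J

/-- Riemannian metrics on the Grassmannian. -/
structure IsRiemannianMetric {m n : ℕ} (g : RealField m n) : Prop where
  smooth : ∀ (A : Frame m n) (a b : Idx m n), ContDiff ℝ ∞ fun x => g.inChart A x a b
  symm : ∀ (U : Gr m n) (θ η : Tang U), g U θ η = g U η θ
  pos : ∀ (U : Gr m n) (θ : Tang U), θ ≠ 0 → 0 < g U θ θ

/-- `k` is an infinitesimal Einstein deformation of the Einstein metric `g` with `Ric(g) = lam g`,
`lam > 0`. The equations are tensorial; they are imposed at every point `U` of the
Grassmannian, in the coordinates centred at `U`. -/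
structure IsEID {m n : ℕ} (g : RealField m n) (lam : ℝ) (k : RealField m n) : Prop where
  metric : IsRiemannianMetric g
  lam_pos : 0 < lam
  einstein : ∀ (U : Gr m n) (A : Frame m n), chart A 0 = U → ∀ b c : Idx m n,
    ricci (g.inChart A) b c 0 = lam * g.inChart A 0 b c
  smooth : ∀ (A : Frame m n) (a b : Idx m n), ContDiff ℝ ∞ fun x => k.inChart A x a b
  symm : ∀ (U : Gr m n) (θ η : Tang U), k U θ η = k U η θ
  trace_free : ∀ (U : Gr m n) (A : Frame m n), chart A 0 = U →
    traceTensor (g.inChart A) (k.inChart A) 0 = 0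
  div_free : ∀ (U : Gr m n) (A : Frame m n), chart A 0 = U → ∀ c : Idx m n,
    divTensor (g.inChart A) (k.inChart A) c 0 = 0
  lin_einstein : ∀ (U : Gr m n) (A : Frame m n), chart A 0 = U → ∀ b c : Idx m n,
    connLaplacian (g.inChart A) (k.inChart A) b c 0 +
      2 * curvOp (g.inChart A) (k.inChart A) b c 0 = 0

/-- The equations `Λσ = 0`, `∂̄*σ = 0` and `Δ_∂̄ σ = lam σ` for the (1,1)-form `σ` associated to `h`,
with respect to the Kähler metric `g`, at every point of the Grassmannian. -/
structure IsKahlerEID {m n : ℕ} (g : SesqField m n) (lam : ℝ) (h : SesqField m n) : Prop where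
  trace_free : ∀ (U : Gr m n) (A : Frame m n), chart A 0 = U →
    lefschetzAdj (g.inChart A) (h.form A) 0 = 0
  coclosed : ∀ (U : Gr m n) (A : Frame m n), chart A 0 = U → ∀ I : Fin n × Fin m,
    dbarStar11 (g.inChart A) (h.form A) I 0 = 0
  eigen : ∀ (U : Gr m n) (A : Frame m n), chart A 0 = U → ∀ I J : Fin n × Fin m,
    dbarLaplacian (g.inChart A) (h.form A) I J 0 = (lam : ℂ) * h.form A I J 0

/-! ### The Fubini-Study metric and the tensors attached to `γ` -/

/-- The sesquilinear form `P_γ(v₁, v₂) = v₂* γ v₁` on `ℂ^{n+m}`. -/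
def sesq {m n : ℕ} (γ : Matrix (Fin m ⊕ Fin n) (Fin m ⊕ Fin n) ℂ) :
    Amb m n →ₗ[ℂ] Amb m n →ₗ⋆[ℂ] ℂ :=
  LinearMap.mk₂'ₛₗ (RingHom.id ℂ) (starRingEnd ℂ)
    (fun v w => inner ℂ w (Matrix.toEuclideanLin γ v))
    (by intros; simp) (by intros; simp) (by intros; simp) (by intros; simp [mul_comm])

/-- The restriction of a sesquilinear form to a subspace. -/
def restr {m n : ℕ} (P : Amb m n →ₗ[ℂ] Amb m n →ₗ⋆[ℂ] ℂ) (S : Submodule ℂ (Amb m n)) :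
    S →ₗ[ℂ] S →ₗ⋆[ℂ] ℂ :=
  LinearMap.mk₂'ₛₗ (RingHom.id ℂ) (starRingEnd ℂ) (fun v w => P v w)
    (by intros; simp) (by intros; simp) (by intros; simp) (by intros; simp)

/-- The vector `α♯` of `S` with `α(v) = ⟨v, α♯⟩`. -/
def sharp {m n : ℕ} {S : Submodule ℂ (Amb m n)} (α : Module.Dual ℂ S) : S :=
  (InnerProductSpace.toDual ℂ S).symm (LinearMap.toContinuousLinearMap α)

/-- The form on the dual `S*` induced by a form `P` on `S` and the Hermitian metric of `S`:
`P*(α, β) = P(β♯, α♯)`. -/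
def dualForm {m n : ℕ} {S : Submodule ℂ (Amb m n)} (P : S →ₗ[ℂ] S →ₗ⋆[ℂ] ℂ)
    (α β : Module.Dual ℂ S) : ℂ :=
  P (sharp β) (sharp α)

/-- The product `P₁ · P₂` on `U* ⊗ U^⊥ = Hom(U, U^⊥)` of a form on `U*` and a form on `U^⊥`,
determined by `(P₁ · P₂)(α ⊗ u, β ⊗ v) = P₁(α, β) P₂(u, v)`; it is written out with
`θ = ∑ e_i* ⊗ θ(e_i)`. -/
def prodForm {m n : ℕ} {U : Gr m n} (P₁ : Module.Dual ℂ U.1 → Module.Dual ℂ U.1 → ℂ)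
    (P₂ : (U.1)ᗮ →ₗ[ℂ] (U.1)ᗮ →ₗ⋆[ℂ] ℂ) : Tang U →ₗ[ℂ] Tang U →ₗ⋆[ℂ] ℂ :=
  LinearMap.mk₂'ₛₗ (RingHom.id ℂ) (starRingEnd ℂ)
    (fun θ η => ∑ i, ∑ j, P₁ ((stdOrthonormalBasis ℂ U.1).toBasis.coord i)
      ((stdOrthonormalBasis ℂ U.1).toBasis.coord j) *
        P₂ (θ (stdOrthonormalBasis ℂ U.1 i)) (η (stdOrthonormalBasis ℂ U.1 j)))
    (fun θ θ' η => by
      simp only [LinearMap.add_apply, map_add, mul_add, Finset.sum_add_distrib])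
    (fun c θ η => by
      simp only [LinearMap.smul_apply, LinearMap.map_smul, smul_eq_mul, Finset.mul_sum]
      refine Finset.sum_congr rfl fun i _ => Finset.sum_congr rfl fun j _ => ?_
      exact mul_left_comm _ _ _)
    (fun θ η η' => by
      simp only [LinearMap.add_apply, map_add, mul_add, Finset.sum_add_distrib])
    (fun c θ η => by
      simp only [LinearMap.smul_apply, LinearMap.map_smulₛₗ, smul_eq_mul, Finset.mul_sum]
      refine Finset.sum_congr rfl fun i _ => Finset.sum_congr rfl fun j _ => ?_
      exact mul_left_comm _ _ _)

/-- The Fubini-Study metric `g = g₁ · g₂`, with `g₁`, `g₂` the Hermitian metrics on `U*` and `U^⊥`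
induced by the standard Hermitian metric of `ℂ^{n+m}`. -/
def fubiniStudy (m n : ℕ) : SesqField m n := fun U =>
  prodForm (dualForm (restr (sesq 1) U.1)) (restr (sesq 1) (U.1)ᗮ)

/-- `h₁`, the product of `g₁` and the restriction of `P_γ` to `U^⊥`. -/
def h₁ {m n : ℕ} (γ : Matrix (Fin m ⊕ Fin n) (Fin m ⊕ Fin n) ℂ) : SesqField m n := fun U =>
  prodForm (dualForm (restr (sesq 1) U.1)) (restr (sesq γ) (U.1)ᗮ)

/-- `h₂`, the product of the form induced by `P_γ` on `U*` and `g₂`. -/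
def h₂ {m n : ℕ} (γ : Matrix (Fin m ⊕ Fin n) (Fin m ⊕ Fin n) ℂ) : SesqField m n := fun U =>
  prodForm (dualForm (restr (sesq γ) U.1)) (restr (sesq 1) (U.1)ᗮ)

/-- `f_γ(U) = ∑ P_γ(η_i, η_i)` over an orthonormal basis of `U`. -/
def fγ {m n : ℕ} (γ : Matrix (Fin m ⊕ Fin n) (Fin m ⊕ Fin n) ℂ) (U : Gr m n) : ℂ :=
  ∑ i, restr (sesq γ) U.1 (stdOrthonormalBasis ℂ U.1 i) (stdOrthonormalBasis ℂ U.1 i)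

/-- `h₃ = f_γ g`. -/
def h₃ {m n : ℕ} (γ : Matrix (Fin m ⊕ Fin n) (Fin m ⊕ Fin n) ℂ) : SesqField m n := fun U =>
  fγ γ U • fubiniStudy m n U

/-- `D_γ = n(1 - m²) h₁ + m(1 - n²) h₂ + (n² - m²) h₃`. -/
def deformation {m n : ℕ} (γ : Matrix (Fin m ⊕ Fin n) (Fin m ⊕ Fin n) ℂ) : SesqField m n :=
  fun U => ((n : ℂ) * (1 - (m : ℂ) ^ 2)) • h₁ γ U + ((m : ℂ) * (1 - (n : ℂ) ^ 2)) • h₂ γ U +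
    ((n : ℂ) ^ 2 - (m : ℂ) ^ 2) • h₃ γ U

end GrassmannEID

end

/-!
All equations are imposed at the centre of a chart `W ↦ A (I; W)`, and there everything is explicit.
With `E = (I; W)` spanning the plane, `F = (-W*; I)` spanning its complement and `α` replaced by
`A* α A`, the field attached to forms `α` on `U*` and `β` on `U^⊥` has the components
`tr(S_α Y* T_β X)`, where `S_α = (E*E)⁻¹ E*αE (E*E)⁻¹` and `T_β = (F*F)⁻¹ F*βF (F*F)⁻¹`
(`prodForm_chart`). Since `(1 + W*W)⁻¹ = 1 - W*W + ⋯`, the 2-jets of these functions at `W = 0` can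
be read off (`prodForm_jet`). The Fubini-Study metric has no first-order part, so the coordinates are
normal at the centre: Christoffel symbols vanish there, and all the operators involved reduce to
contractions of the second derivatives of `g` and of `h` (`NormalAt`, `KNormalAt`). In particular the
curvature is `R(A, B) C = A B* C + C B* A - B A* C - C A* B` (`riemann_fubiniStudy`), whose trace gives
the Einstein constant `n + m`.

The second derivatives of `h₁`, `h₂`, `h₃` are of mixed type: a sum of terms `tr(P* t Q s)`, conjugate
linear in one direction and linear in the other. The contraction of such a term over the coordinate
vectors is `tr t · tr s` (`sum_contr`). With `a`, `d` the diagonal blocks of `γ`, the quantity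
`∑ ∂_I ∂_Ī h + (n + m) h + ∑ h(E_I Y* X + X Y* E_I, E_I)` becomes a multiple of `tr a + tr d = 0` for each
of the three tensors separately (`sum_devHess`). This one identity is both the linearized Einstein
equation and the eigenvalue equation for `Δ_∂̄`; in the latter the terms of `∂̄ ∂̄*` and `∂̄* ∂̄` in
which both derivatives fall on `h` cancel up to `-∑ ∂_I ∂_Ī h` (`KNormalAt.dbarLaplacian_eq`).

The coefficients matter only for the trace and for the divergence. With the block `b` of `γ` from `ℂ^m`
to `ℂ^n`, the divergence of `k₁ h₁ + k₂ h₂ + k₃ h₃` is a multiple of `(-n k₁ + m k₂ + k₃) tr(Y* b)`, and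
its trace is a combination of `tr a` and `tr d`, a multiple of `tr a + tr d = 0` for the given
coefficients, for which the divergence vanishes too (`coclosed_coeff`, `sum_devValue_deformation`).
-/

noncomputable section

namespace GrassmannEID

/-! ### Partial derivatives and 2-jets -/

section Jets

variable {ι : Type*} [Fintype ι] [DecidableEq ι]
variable {F : Type*} [NormedAddCommGroup F] [NormedSpace ℝ F]

theorem pd_contDiff {u : (ι → ℝ) → F} (hu : ContDiff ℝ ∞ u) (a : ι) : ContDiff ℝ ∞ (pd a u) := by
  unfold pd
  exact (hu.fderiv_right (m := ∞) (by simp)).clm_apply contDiff_const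

omit [DecidableEq ι] in
theorem smooth_diffAt {u : (ι → ℝ) → F} (hu : ContDiff ℝ ∞ u) (x : ι → ℝ) :
    DifferentiableAt ℝ u x :=
  (hu.differentiable (by simp)).differentiableAt

theorem pd_const (a : ι) (c : F) (x : ι → ℝ) : pd a (fun _ => c) x = 0 := by
  simp [pd]

theorem pd_add {u v : (ι → ℝ) → F} {x : ι → ℝ} (hu : DifferentiableAt ℝ u x)
    (hv : DifferentiableAt ℝ v x) (a : ι) :
    pd a (fun y => u y + v y) x = pd a u x + pd a v x := by
  simp [pd, fderiv_fun_add hu hv]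

theorem pd_sub {u v : (ι → ℝ) → F} {x : ι → ℝ} (hu : DifferentiableAt ℝ u x)
    (hv : DifferentiableAt ℝ v x) (a : ι) :
    pd a (fun y => u y - v y) x = pd a u x - pd a v x := by
  simp [pd, fderiv_fun_sub hu hv]

theorem pd_sum {κ : Type*} (s : Finset κ) {u : κ → (ι → ℝ) → F} {x : ι → ℝ}
    (hu : ∀ k ∈ s, DifferentiableAt ℝ (u k) x) (a : ι) :
    pd a (fun y => ∑ k ∈ s, u k y) x = ∑ k ∈ s, pd a (u k) x := by
  simp [pd, fderiv_fun_sum hu]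

theorem pd_mul {R : Type*} [NormedCommRing R] [NormedAlgebra ℝ R] {u v : (ι → ℝ) → R} {x : ι → ℝ}
    (hu : DifferentiableAt ℝ u x) (hv : DifferentiableAt ℝ v x) (a : ι) :
    pd a (fun y => u y * v y) x = pd a u x * v x + u x * pd a v x := by
  simp only [pd, fderiv_fun_mul hu hv]
  simp [add_comm, mul_comm]

theorem pd_const_mul {R : Type*} [NormedCommRing R] [NormedAlgebra ℝ R] (c : R)
    {v : (ι → ℝ) → R} {x : ι → ℝ} (hv : DifferentiableAt ℝ v x) (a : ι) :
    pd a (fun y => c * v y) x = c * pd a v x := by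
  rw [pd_mul (differentiableAt_const c) hv, pd_const]; simp

omit [DecidableEq ι] in
theorem diffAt_div_const {R : Type*} [NormedField R] [NormedAlgebra ℝ R] {u : (ι → ℝ) → R}
    {x : ι → ℝ} (hu : DifferentiableAt ℝ u x) (c : R) : DifferentiableAt ℝ (fun y => u y / c) x := by
  simpa only [div_eq_mul_inv] using hu.mul_const c⁻¹

theorem pd_clm {G : Type*} [NormedAddCommGroup G] [NormedSpace ℝ G] (T : F →L[ℝ] G)
    {u : (ι → ℝ) → F} {x : ι → ℝ} (hu : DifferentiableAt ℝ u x) (a : ι) :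
    pd a (fun y => T (u y)) x = T (pd a u x) := by
  have : fderiv ℝ (fun y => T (u y)) x = T.comp (fderiv ℝ u x) :=
    (T.hasFDerivAt.comp x hu.hasFDerivAt).fderiv
  simp [pd, this]

/-- The smooth function `u` has at the origin the value `c`, the first partial derivatives `l a`
and the second partial derivatives `q a b`. -/
structure Jet2 (u : (ι → ℝ) → F) (c : F) (l : ι → F) (q : ι → ι → F) : Prop where
  smooth : ContDiff ℝ ∞ u
  val : u 0 = c
  fst : ∀ a, pd a u 0 = l a
  snd : ∀ a b, pd a (pd b u) 0 = q a b

namespace Jet2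

theorem congr {u : (ι → ℝ) → F} {c c' : F} {l l' : ι → F} {q q' : ι → ι → F} (h : Jet2 u c l q)
    (hc : c = c') (hl : ∀ a, l a = l' a) (hq : ∀ a b, q a b = q' a b) : Jet2 u c' l' q' :=
  ⟨h.smooth, h.val.trans hc, fun a => (h.fst a).trans (hl a), fun a b => (h.snd a b).trans (hq a b)⟩

theorem const (c : F) : Jet2 (fun _ : ι → ℝ => c) c (fun _ => 0) (fun _ _ => 0) := by
  refine ⟨contDiff_const, rfl, fun a => pd_const a c 0, fun a b => ?_⟩
  have : pd b (fun _ : ι → ℝ => c) = fun _ => 0 := funext fun x => pd_const b c x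
  rw [this, pd_const]

theorem add {u v : (ι → ℝ) → F} {c c' : F} {l l' : ι → F} {q q' : ι → ι → F}
    (hu : Jet2 u c l q) (hv : Jet2 v c' l' q') :
    Jet2 (fun x => u x + v x) (c + c') (fun a => l a + l' a) (fun a b => q a b + q' a b) := by
  refine ⟨hu.smooth.add hv.smooth, by rw [hu.val, hv.val], fun a => ?_, fun a b => ?_⟩
  · rw [pd_add (smooth_diffAt hu.smooth 0) (smooth_diffAt hv.smooth 0), hu.fst, hv.fst]
  · have : pd b (fun x => u x + v x) = fun x => pd b u x + pd b v x := funext fun x =>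
      pd_add (smooth_diffAt hu.smooth x) (smooth_diffAt hv.smooth x) b
    rw [this, pd_add (smooth_diffAt (pd_contDiff hu.smooth b) 0)
      (smooth_diffAt (pd_contDiff hv.smooth b) 0), hu.snd, hv.snd]

theorem sum {κ : Type*} (s : Finset κ) {u : κ → (ι → ℝ) → F} {c : κ → F} {l : κ → ι → F}
    {q : κ → ι → ι → F} (h : ∀ k, Jet2 (u k) (c k) (l k) (q k)) :
    Jet2 (fun x => ∑ k ∈ s, u k x) (∑ k ∈ s, c k) (fun a => ∑ k ∈ s, l k a)
      (fun a b => ∑ k ∈ s, q k a b) := by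
  classical
  induction s using Finset.induction_on with
  | empty => simpa using const (0 : F)
  | insert k s hk ih => simpa [Finset.sum_insert hk] using (h k).add ih

theorem clm {G : Type*} [NormedAddCommGroup G] [NormedSpace ℝ G] (T : F →L[ℝ] G)
    {u : (ι → ℝ) → F} {c : F} {l : ι → F} {q : ι → ι → F} (hu : Jet2 u c l q) :
    Jet2 (fun x => T (u x)) (T c) (fun a => T (l a)) (fun a b => T (q a b)) := by
  refine ⟨T.contDiff.comp hu.smooth, by rw [hu.val], fun a => ?_, fun a b => ?_⟩
  · rw [pd_clm T (smooth_diffAt hu.smooth 0), hu.fst]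
  · have : pd b (fun x => T (u x)) = fun x => T (pd b u x) := funext fun x =>
      pd_clm T (smooth_diffAt hu.smooth x) b
    rw [this, pd_clm T (smooth_diffAt (pd_contDiff hu.smooth b) 0), hu.snd]

theorem mul {R : Type*} [NormedCommRing R] [NormedAlgebra ℝ R] {u v : (ι → ℝ) → R} {c c' : R}
    {l l' : ι → R} {q q' : ι → ι → R} (hu : Jet2 u c l q) (hv : Jet2 v c' l' q') :
    Jet2 (fun x => u x * v x) (c * c') (fun a => l a * c' + c * l' a)
      (fun a b => q a b * c' + l a * l' b + l b * l' a + c * q' a b) := by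
  have du := fun x => smooth_diffAt hu.smooth x
  have dv := fun x => smooth_diffAt hv.smooth x
  have du' := fun b x => smooth_diffAt (pd_contDiff hu.smooth b) x
  have dv' := fun b x => smooth_diffAt (pd_contDiff hv.smooth b) x
  refine ⟨hu.smooth.mul hv.smooth, by rw [hu.val, hv.val], fun a => ?_, fun a b => ?_⟩
  · rw [pd_mul (du 0) (dv 0), hu.fst, hv.fst, hu.val, hv.val]
  · have : pd b (fun x => u x * v x) = fun x => pd b u x * v x + u x * pd b v x := funext fun x =>
      pd_mul (du x) (dv x) b
    rw [this, pd_add ((du' b 0).fun_mul (dv 0)) ((du 0).fun_mul (dv' b 0)), pd_mul (du' b 0) (dv 0),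
      pd_mul (du 0) (dv' b 0)]
    simp only [hu.fst, hv.fst, hu.val, hv.val, hu.snd, hv.snd]
    ring

end Jet2

/-- The entrywise `Jet2` of a matrix-valued function. -/
def MatJet {p q : Type*} (u : (ι → ℝ) → Matrix p q ℂ) (c : Matrix p q ℂ) (l : ι → Matrix p q ℂ)
    (s : ι → ι → Matrix p q ℂ) : Prop :=
  ∀ i j, Jet2 (fun x => u x i j) (c i j) (fun a => l a i j) (fun a b => s a b i j)

namespace MatJet

theorem congr {p q : Type*} {u : (ι → ℝ) → Matrix p q ℂ} {c c' : Matrix p q ℂ}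
    {l l' : ι → Matrix p q ℂ} {s s' : ι → ι → Matrix p q ℂ} (h : MatJet u c l s)
    (hc : c = c') (hl : ∀ a, l a = l' a) (hs : ∀ a b, s a b = s' a b) : MatJet u c' l' s' :=
  fun i j => (h i j).congr (by rw [hc]) (fun a => by rw [hl]) (fun a b => by rw [hs])

theorem const {p q : Type*} (c : Matrix p q ℂ) :
    MatJet (fun _ : ι → ℝ => c) c (fun _ => 0) (fun _ _ => 0) :=
  fun i j => Jet2.const (c i j)

theorem add {p q : Type*} {u v : (ι → ℝ) → Matrix p q ℂ} {c c' : Matrix p q ℂ}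
    {l l' : ι → Matrix p q ℂ} {s s' : ι → ι → Matrix p q ℂ} (hu : MatJet u c l s)
    (hv : MatJet v c' l' s') :
    MatJet (fun x => u x + v x) (c + c') (fun a => l a + l' a) (fun a b => s a b + s' a b) :=
  fun i j => (hu i j).add (hv i j)

theorem mul {p q r : Type*} [Fintype q] {u : (ι → ℝ) → Matrix p q ℂ}
    {v : (ι → ℝ) → Matrix q r ℂ} {c : Matrix p q ℂ} {c' : Matrix q r ℂ}
    {l : ι → Matrix p q ℂ} {l' : ι → Matrix q r ℂ} {s : ι → ι → Matrix p q ℂ}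
    {s' : ι → ι → Matrix q r ℂ} (hu : MatJet u c l s) (hv : MatJet v c' l' s') :
    MatJet (fun x => u x * v x) (c * c') (fun a => l a * c' + c * l' a)
      (fun a b => s a b * c' + l a * l' b + l b * l' a + c * s' a b) := by
  intro i j
  refine (Jet2.sum Finset.univ fun k => (hu i k).mul (hv k j)).congr ?_ ?_ ?_ <;>
    simp [Matrix.mul_apply, Finset.sum_add_distrib]

theorem trace {p : Type*} [Fintype p] {u : (ι → ℝ) → Matrix p p ℂ} {c : Matrix p p ℂ}
    {l : ι → Matrix p p ℂ} {s : ι → ι → Matrix p p ℂ} (hu : MatJet u c l s) :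
    Jet2 (fun x => (u x).trace) c.trace (fun a => (l a).trace) (fun a b => (s a b).trace) :=
  Jet2.sum Finset.univ fun k => hu k k

end MatJet

end Jets

/-! ### Derivatives of inverse matrices -/

section Inverse

theorem contDiff_det {E : Type*} [NormedAddCommGroup E] [NormedSpace ℝ E] {R : Type*}
    [NormedField R] [NormedAlgebra ℝ R] {p : Type*} [Fintype p] [DecidableEq p]
    {g : E → Matrix p p R} (hg : ∀ i j, ContDiff ℝ ∞ fun x => g x i j) :
    ContDiff ℝ ∞ fun x => (g x).det := by
  simp only [Matrix.det_apply]
  refine ContDiff.sum fun σ _ => ContDiff.const_smul _ ?_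
  exact contDiff_prod fun i _ => hg _ _

theorem contDiff_adjugate {E : Type*} [NormedAddCommGroup E] [NormedSpace ℝ E] {R : Type*}
    [NormedField R] [NormedAlgebra ℝ R] {p : Type*} [Fintype p] [DecidableEq p]
    {g : E → Matrix p p R} (hg : ∀ i j, ContDiff ℝ ∞ fun x => g x i j) (i j : p) :
    ContDiff ℝ ∞ fun x => (g x).adjugate i j := by
  simp only [Matrix.adjugate_apply]
  refine contDiff_det fun k l => ?_
  by_cases hk : k = j
  · subst hk; simpa using contDiff_const
  · simpa [Matrix.updateRow_ne hk] using hg k l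

theorem contDiff_inv_entry {E : Type*} [NormedAddCommGroup E] [NormedSpace ℝ E] {R : Type*}
    [NormedField R] [NormedAlgebra ℝ R] {p : Type*} [Fintype p] [DecidableEq p]
    {g : E → Matrix p p R} (hg : ∀ i j, ContDiff ℝ ∞ fun x => g x i j)
    (hd : ∀ x, (g x).det ≠ 0) (i j : p) :
    ContDiff ℝ ∞ fun x => (g x)⁻¹ i j := by
  simp only [Matrix.inv_def, Ring.inverse_eq_inv', Matrix.smul_apply, smul_eq_mul]
  exact ((contDiff_det hg).inv hd).mul (contDiff_adjugate hg i j)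

theorem differentiableAt_inv_entry {E : Type*} [NormedAddCommGroup E] [NormedSpace ℝ E] {R : Type*}
    [NormedField R] [NormedAlgebra ℝ R] {p : Type*} [Fintype p] [DecidableEq p]
    {g : E → Matrix p p R} (hg : ∀ i j, ContDiff ℝ ∞ fun x => g x i j) {x : E}
    (hd : (g x).det ≠ 0) (i j : p) : DifferentiableAt ℝ (fun x => (g x)⁻¹ i j) x := by
  simp only [Matrix.inv_def, Ring.inverse_eq_inv', Matrix.smul_apply, smul_eq_mul]
  exact (((contDiff_det hg).differentiable (by simp)).differentiableAt.inv hd).mul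
    ((contDiff_adjugate hg i j).differentiable (by simp)).differentiableAt

variable {ι : Type*} [Fintype ι] [DecidableEq ι]

/-- The derivative of `g⁻¹` vanishes where that of `g` does: differentiate `g⁻¹ g = 1`, which holds
near every point at which `g` is invertible. -/
theorem pd_inv_entry {R : Type*} [NormedField R] [NormedAlgebra ℝ R] {p : Type*} [Fintype p]
    [DecidableEq p] {g : (ι → ℝ) → Matrix p p R} (hg : ∀ i j, ContDiff ℝ ∞ fun x => g x i j)
    {x : ι → ℝ} (hd : (g x).det ≠ 0) (h0 : ∀ a i j, pd a (fun y => g y i j) x = 0)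
    (a : ι) (i j : p) : pd a (fun y => (g y)⁻¹ i j) x = 0 := by
  have hdi := fun i j => differentiableAt_inv_entry (x := x) hg hd i j
  have hdg := fun i j => smooth_diffAt (hg i j) x
  have key : ∀ k, ∑ l, pd a (fun y => (g y)⁻¹ i l) x * g x l k = 0 := by
    intro k
    have hev : (fun y => ∑ l, (g y)⁻¹ i l * g y l k) =ᶠ[nhds x] fun _ => (1 : Matrix p p R) i k := by
      filter_upwards [(contDiff_det hg).continuous.continuousAt.eventually_ne hd] with y hy
      rw [← Matrix.mul_apply, Matrix.nonsing_inv_mul _ (isUnit_iff_ne_zero.2 hy)]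
    have h1 : pd a (fun y => ∑ l, (g y)⁻¹ i l * g y l k) x = 0 := by
      rw [pd, hev.fderiv_eq]; simp
    rw [pd_sum _ (fun l _ => (hdi i l).fun_mul (hdg l k))] at h1
    simpa [pd_mul (hdi i _) (hdg _ k), h0] using h1
  have h2 : (fun l => pd a (fun y => (g y)⁻¹ i l) x) ᵥ* g x = 0 := by
    funext k; simpa [Matrix.vecMul, dotProduct] using key k
  have h3 := congrArg (fun v => v ᵥ* (g x)⁻¹) h2
  simp only [Matrix.vecMul_vecMul, Matrix.mul_nonsing_inv _ (isUnit_iff_ne_zero.2 hd),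
    Matrix.vecMul_one, Matrix.zero_vecMul] at h3
  exact congrFun h3 j

end Inverse

/-! ### Riemannian operators at the centre of normal coordinates -/

section NormalReal

variable {ι : Type*} [Fintype ι] [DecidableEq ι]

/-- The coordinates are normal at the origin for `g`, up to the scale `r`: there `g = r δ` and the
first derivatives of `g` vanish. -/
structure NormalAt (r : ℝ) (g : (ι → ℝ) → Matrix ι ι ℝ) : Prop where
  pos : 0 < r
  smooth : ∀ a b, ContDiff ℝ ∞ fun x => g x a b
  val : g 0 = r • 1
  fst : ∀ a b c, pd a (fun x => g x b c) 0 = 0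

/-- The second partial derivatives `∂_e ∂_a h_{bc}` at the origin. -/
def pd2 (h : (ι → ℝ) → Matrix ι ι ℝ) (b c e a : ι) : ℝ := pd e (pd a fun x => h x b c) 0

namespace NormalAt

variable {r : ℝ} {g : (ι → ℝ) → Matrix ι ι ℝ} (hg : NormalAt r g)
include hg

theorem det_ne : (g 0).det ≠ 0 := by
  rw [hg.val, Matrix.det_smul, Matrix.det_one, mul_one]
  exact pow_ne_zero _ hg.pos.ne'

theorem inv_val : (g 0)⁻¹ = r⁻¹ • 1 := by
  refine Matrix.inv_eq_left_inv ?_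
  rw [hg.val, Matrix.smul_mul, Matrix.one_mul, smul_smul, inv_mul_cancel₀ hg.pos.ne', one_smul]

theorem inv_apply (a b : ι) : (g 0)⁻¹ a b = if a = b then r⁻¹ else 0 := by
  simp [hg.inv_val, Matrix.one_apply]

theorem sum_inv (f : ι → ι → ℝ) : ∑ a, ∑ b, (g 0)⁻¹ a b * f a b = r⁻¹ * ∑ a, f a a := by
  simp [hg.inv_apply, Finset.mul_sum]

theorem christoffel_zero (c a b : ι) : christoffel g c a b 0 = 0 := by
  simp [christoffel, hg.fst]

theorem diff_christoffel (c a b : ι) : DifferentiableAt ℝ (christoffel g c a b) 0 := by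
  have d := fun a i j => smooth_diffAt (pd_contDiff (hg.smooth i j) a) 0
  unfold christoffel
  refine DifferentiableAt.fun_sum fun e _ => ?_
  exact diffAt_div_const ((differentiableAt_inv_entry hg.smooth hg.det_ne c e).fun_mul
    (((d _ _ _).fun_add (d _ _ _)).fun_sub (d _ _ _))) _

/-- The derivative of the inverse metric does not enter, as it is multiplied by first derivatives
of the metric. -/
theorem pd_christoffel (e c a b : ι) : pd e (christoffel g c a b) 0 =
    r⁻¹ * (pd2 g b c e a + pd2 g a c e b - pd2 g a b e c) / 2 := by
  have d := fun a i j => smooth_diffAt (pd_contDiff (hg.smooth i j) a) 0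
  have di := fun c e => differentiableAt_inv_entry hg.smooth hg.det_ne c e
  have h : ∀ k, pd e (fun x => (g x)⁻¹ c k * (pd a (fun y => g y b k) x +
      pd b (fun y => g y a k) x - pd k (fun y => g y a b) x) / 2) 0 =
      (g 0)⁻¹ c k * (pd2 g b k e a + pd2 g a k e b - pd2 g a b e k) / 2 := by
    intro k
    have hs := ((d a b k).fun_add (d b a k)).fun_sub (d k a b)
    have hm : (fun x => (g x)⁻¹ c k * (pd a (fun y => g y b k) x +
      pd b (fun y => g y a k) x - pd k (fun y => g y a b) x) / 2) = fun x => (1 / 2 : ℝ) *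
        ((g x)⁻¹ c k * (pd a (fun y => g y b k) x +
      pd b (fun y => g y a k) x - pd k (fun y => g y a b) x)) := by
      funext x; ring
    rw [hm, pd_const_mul _ ((di c k).fun_mul hs), pd_mul (di c k) hs,
      pd_inv_entry hg.smooth hg.det_ne hg.fst, pd_sub ((d a b k).fun_add (d b a k)) (d k a b),
      pd_add (d a b k) (d b a k)]
    simp only [pd2]
    ring
  unfold christoffel
  rw [pd_sum]
  · simp only [h, hg.inv_apply, ite_mul, zero_mul, ite_div, zero_div]
    simp
  · intro k _
    exact diffAt_div_const ((di c k).fun_mul (((d _ _ _).fun_add (d _ _ _)).fun_sub (d _ _ _))) _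

theorem riemann_eq (d c a b : ι) : riemann g d c a b 0 =
    pd a (christoffel g d b c) 0 - pd b (christoffel g d a c) 0 := by
  simp [riemann, hg.christoffel_zero]

theorem nabla_eq (h : (ι → ℝ) → Matrix ι ι ℝ) (a b c : ι) :
    nabla g h a b c 0 = pd a (fun y => h y b c) 0 := by
  simp [nabla, hg.christoffel_zero]

theorem nabla2_eq {h : (ι → ℝ) → Matrix ι ι ℝ} (hh : ∀ a b, ContDiff ℝ ∞ fun x => h x a b)
    (e a b c : ι) : nabla2 g h e a b c 0 = pd2 h b c e a -
      ∑ d, (pd e (christoffel g d a b) 0 * h 0 d c + pd e (christoffel g d a c) 0 * h 0 b d) := by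
  have dh := fun a b => smooth_diffAt (hh a b) 0
  have dc := hg.diff_christoffel
  have h1 : pd e (nabla g h a b c) 0 = pd2 h b c e a -
      ∑ d, (pd e (christoffel g d a b) 0 * h 0 d c + pd e (christoffel g d a c) 0 * h 0 b d) := by
    unfold nabla
    rw [pd_sub (smooth_diffAt (pd_contDiff (hh b c) a) 0), pd_sum]
    · simp only [pd2]
      congr 1
      refine Finset.sum_congr rfl fun d _ => ?_
      rw [pd_add ((dc d a b).fun_mul (dh d c)) ((dc d a c).fun_mul (dh b d)),
        pd_mul (dc d a b) (dh d c), pd_mul (dc d a c) (dh b d)]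
      simp [hg.christoffel_zero]
    · exact fun d _ => ((dc d a b).fun_mul (dh d c)).fun_add ((dc d a c).fun_mul (dh b d))
    · exact DifferentiableAt.fun_sum fun d _ =>
        ((dc d a b).fun_mul (dh d c)).fun_add ((dc d a c).fun_mul (dh b d))
  simp [nabla2, hg.christoffel_zero, h1]

theorem traceTensor_eq (h : (ι → ℝ) → Matrix ι ι ℝ) :
    traceTensor g h 0 = r⁻¹ * ∑ a, h 0 a a := hg.sum_inv _

theorem divTensor_eq (h : (ι → ℝ) → Matrix ι ι ℝ) (c : ι) :
    divTensor g h c 0 = r⁻¹ * ∑ a, pd a (fun y => h y a c) 0 := by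
  simp only [divTensor, hg.nabla_eq]
  exact hg.sum_inv fun a b => pd a (fun y => h y b c) 0

theorem curvOp_eq (h : (ι → ℝ) → Matrix ι ι ℝ) (b c : ι) :
    curvOp g h b c 0 = r⁻¹ * ∑ a, ∑ d, riemann g d c a b 0 * h 0 d a :=
  hg.sum_inv fun a e => ∑ d, riemann g d c a b 0 * h 0 d e

theorem connLaplacian_eq {h : (ι → ℝ) → Matrix ι ι ℝ} (hh : ∀ a b, ContDiff ℝ ∞ fun x => h x a b)
    (b c : ι) : connLaplacian g h b c 0 = r⁻¹ * (∑ a, pd2 h b c a a -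
      ∑ d, ((∑ a, pd a (christoffel g d a b) 0) * h 0 d c +
        (∑ a, pd a (christoffel g d a c) 0) * h 0 b d)) := by
  have h1 : connLaplacian g h b c 0 = r⁻¹ * ∑ a, nabla2 g h a a b c 0 :=
    hg.sum_inv fun e a => nabla2 g h e a b c 0
  rw [h1]
  simp only [hg.nabla2_eq hh, Finset.sum_sub_distrib]
  congr 2
  rw [Finset.sum_comm]
  simp only [Finset.sum_add_distrib, Finset.sum_mul]

end NormalAt

end NormalReal

/-! ### Kähler operators at the centre of normal coordinates -/

section NormalKahler

variable {K : Type*} [Fintype K] [DecidableEq K]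

/-- The metric `g` is the identity at the origin and its first derivatives vanish there. -/
structure KNormalAt (g : (K × Fin 2 → ℝ) → Matrix K K ℂ) : Prop where
  smooth : ∀ I J, ContDiff ℝ ∞ fun x => g x I J
  val : g 0 = 1
  fst : ∀ a I J, pd a (fun x => g x I J) 0 = 0

theorem dw_diffAt {u : (K × Fin 2 → ℝ) → ℂ} (hu : ContDiff ℝ ∞ u) (I : K) (x : K × Fin 2 → ℝ) :
    DifferentiableAt ℝ (dw I u) x := by
  have d := fun a => smooth_diffAt (pd_contDiff hu a) x
  unfold dw
  exact diffAt_div_const ((d _).fun_sub ((d _).const_mul _)) _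

theorem dwbar_sub {u v : (K × Fin 2 → ℝ) → ℂ} {x : K × Fin 2 → ℝ} (hu : DifferentiableAt ℝ u x)
    (hv : DifferentiableAt ℝ v x) (I : K) :
    dwbar I (fun y => u y - v y) x = dwbar I u x - dwbar I v x := by
  simp only [dwbar, pd_sub hu hv]; ring

theorem dwbar_sum {κ : Type*} (s : Finset κ) {u : κ → (K × Fin 2 → ℝ) → ℂ} {x : K × Fin 2 → ℝ}
    (hu : ∀ k ∈ s, DifferentiableAt ℝ (u k) x) (I : K) :
    dwbar I (fun y => ∑ k ∈ s, u k y) x = ∑ k ∈ s, dwbar I (u k) x := by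
  simp only [dwbar, pd_sum s hu, Finset.mul_sum, ← Finset.sum_add_distrib, ← Finset.sum_div]

theorem dwbar_mul {u v : (K × Fin 2 → ℝ) → ℂ} {x : K × Fin 2 → ℝ} (hu : DifferentiableAt ℝ u x)
    (hv : DifferentiableAt ℝ v x) (I : K) :
    dwbar I (fun y => u y * v y) x = dwbar I u x * v x + u x * dwbar I v x := by
  simp only [dwbar, pd_mul hu hv]; ring

/-- The derivatives `∂_A` and `∂_B̄` commute on smooth functions. -/
theorem dwbar_dw_comm {u : (K × Fin 2 → ℝ) → ℂ} (hu : ContDiff ℝ ∞ u) (A B : K)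
    (x : K × Fin 2 → ℝ) : dwbar B (dw A u) x = dw A (dwbar B u) x := by
  -- symmetry of the second derivative
  have hs : ∀ a b, pd a (pd b u) x = pd b (pd a u) x := by
    intro a b
    have hd : DifferentiableAt ℝ (fderiv ℝ u) x :=
      ((hu.fderiv_right (m := ∞) (by simp)).differentiable (by simp)).differentiableAt
    have h2 : ∀ a b, pd a (pd b u) x = fderiv ℝ (fderiv ℝ u) x (Pi.single a 1) (Pi.single b 1) := by
      intro a b
      have hb : pd b u = fun y => ContinuousLinearMap.apply ℝ ℂ (Pi.single b 1) (fderiv ℝ u y) := rfl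
      rw [hb, pd_clm _ hd]; rfl
    rw [h2, h2]
    exact (hu.contDiffAt.isSymmSndFDerivAt (by simp; exact WithTop.coe_le_coe.2 le_top)).eq _ _
  have d := fun a => smooth_diffAt (pd_contDiff hu a) x
  have e1 : ∀ c, pd c (dw A u) x = (pd c (pd (A, 0) u) x - Complex.I * pd c (pd (A, 1) u) x) / 2 := by
    intro c
    have : dw A u = fun y => (1 / 2 : ℂ) * (pd (A, 0) u y - Complex.I * pd (A, 1) u y) := by
      funext y; simp only [dw]; ring
    rw [this, pd_const_mul _ ((d _).fun_sub ((d _).const_mul _)), pd_sub (d _) ((d _).const_mul _),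
      pd_const_mul _ (d _)]
    ring
  have e2 : ∀ c, pd c (dwbar B u) x =
      (pd c (pd (B, 0) u) x + Complex.I * pd c (pd (B, 1) u) x) / 2 := by
    intro c
    have : dwbar B u = fun y => (1 / 2 : ℂ) * (pd (B, 0) u y + Complex.I * pd (B, 1) u y) := by
      funext y; simp only [dwbar]; ring
    rw [this, pd_const_mul _ ((d _).fun_add ((d _).const_mul _)), pd_add (d _) ((d _).const_mul _),
      pd_const_mul _ (d _)]
    ring
  rw [dw, dwbar, e1, e1, e2, e2, hs (B, 0), hs (B, 0), hs (B, 1), hs (B, 1)]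
  ring

namespace KNormalAt

variable {g : (K × Fin 2 → ℝ) → Matrix K K ℂ} (hg : KNormalAt g)
include hg

theorem det_ne : (g 0).det ≠ 0 := by simp [hg.val]

theorem invMetric_val (A B : K) : invMetric g A B 0 = if A = B then 1 else 0 := by
  simp [invMetric, hg.val, Matrix.one_apply, eq_comm]

theorem sum_inv (f : K → K → ℂ) : ∑ A, ∑ B, invMetric g A B 0 * f A B = ∑ A, f A A := by
  simp [hg.invMetric_val]

theorem diff_inv (A B : K) : DifferentiableAt ℝ (invMetric g A B) 0 :=
  differentiableAt_inv_entry hg.smooth hg.det_ne B A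

theorem dwbar_inv (L A B : K) : dwbar L (invMetric g A B) 0 = 0 := by
  have h := fun a => pd_inv_entry hg.smooth hg.det_ne hg.fst a B A
  unfold invMetric
  simp [dwbar, h]

theorem dw_fst (L I J : K) : dw L (fun y => g y I J) 0 = 0 := by simp [dw, hg.fst]

theorem chern_zero (P A I : K) : chern g P A I 0 = 0 := by simp [chern, hg.dw_fst]

theorem diff_chern (P A I : K) : DifferentiableAt ℝ (chern g P A I) 0 := by
  unfold chern
  exact DifferentiableAt.fun_sum fun Q _ => (hg.diff_inv P Q).fun_mul (dw_diffAt (hg.smooth I Q) A 0)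

theorem dwbar_chern (J P A I : K) :
    dwbar J (chern g P A I) 0 = dwbar J (dw A fun y => g y I P) 0 := by
  unfold chern
  rw [dwbar_sum _ fun Q _ => (hg.diff_inv P Q).fun_mul (dw_diffAt (hg.smooth I Q) A 0)]
  simp only [dwbar_mul (hg.diff_inv P _) (dw_diffAt (hg.smooth I _) A 0), hg.dwbar_inv,
    hg.invMetric_val]
  simp

theorem lefschetzAdj_eq (s : K → K → (K × Fin 2 → ℝ) → ℂ) :
    lefschetzAdj g s 0 = -Complex.I * ∑ A, s A A 0 := by
  rw [lefschetzAdj, hg.sum_inv fun I J => s I J 0]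

theorem dbarStar11_eq (s : K → K → (K × Fin 2 → ℝ) → ℂ) (I : K) :
    dbarStar11 g s I 0 = ∑ A, dw A (s I A) 0 := by
  simp only [dbarStar11, hg.chern_zero, zero_mul, Finset.sum_const_zero, sub_zero]
  exact hg.sum_inv fun A B => dw A (s I B) 0

/-- At a normal point the terms of `∂̄ ∂̄* σ` and `∂̄* ∂̄ σ` with both derivatives on `σ` combine to
`-∑ ∂_A ∂_Ā s_{IJ}`; what remains is a curvature term. -/
theorem dbarLaplacian_eq {s : K → K → (K × Fin 2 → ℝ) → ℂ} (hs : ∀ I J, ContDiff ℝ ∞ (s I J))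
    (I J : K) : dbarLaplacian g s I J 0 =
      ∑ A, ∑ P, dw A (dwbar J fun y => g y I P) 0 * s P A 0 - ∑ A, dw A (dwbar A (s I J)) 0 := by
  have ds := fun I J => smooth_diffAt (hs I J) 0
  have dsum : ∀ A B, DifferentiableAt ℝ (fun x => ∑ P, chern g P A I x * s P B x) 0 := fun A B =>
    DifferentiableAt.fun_sum fun P _ => (hg.diff_chern P A I).fun_mul (ds P B)
  have h1 : dbar10 (dbarStar11 g s) I J 0 = -∑ A, (dw A (dwbar J (s I A)) 0 -
      ∑ P, dw A (dwbar J fun y => g y I P) 0 * s P A 0) := by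
    have h2 : ∀ A B, dwbar J (fun x => invMetric g A B x *
        (dw A (s I B) x - ∑ P, chern g P A I x * s P B x)) 0 = invMetric g A B 0 *
        (dw A (dwbar J (s I B)) 0 - ∑ P, dw A (dwbar J fun y => g y I P) 0 * s P B 0) := by
      intro A B
      rw [dwbar_mul (hg.diff_inv A B) ((dw_diffAt (hs I B) A 0).fun_sub (dsum A B)), hg.dwbar_inv,
        dwbar_sub (dw_diffAt (hs I B) A 0) (dsum A B), dwbar_dw_comm (hs I B),
        dwbar_sum _ fun P _ => (hg.diff_chern P A I).fun_mul (ds P B)]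
      simp only [dwbar_mul (hg.diff_chern _ A I) (ds _ B), hg.dwbar_chern, hg.chern_zero,
        dwbar_dw_comm (hg.smooth I _)]
      ring_nf
    have hd : ∀ A B, DifferentiableAt ℝ (fun x => invMetric g A B x *
        (dw A (s I B) x - ∑ P, chern g P A I x * s P B x)) 0 := fun A B =>
      (hg.diff_inv A B).fun_mul ((dw_diffAt (hs I B) A 0).fun_sub (dsum A B))
    simp only [dbar10]
    unfold dbarStar11
    rw [dwbar_sum _ fun A _ => DifferentiableAt.fun_sum fun B _ => hd A B]
    simp only [dwbar_sum _ fun B _ => hd _ B, h2]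
    rw [hg.sum_inv fun A B => dw A (dwbar J (s I B)) 0 -
      ∑ P, dw A (dwbar J fun y => g y I P) 0 * s P B 0]
  have h3 : dbarStar12 g (dbar11 s) I J 0 =
      -∑ A, (dw A (dwbar A (s I J)) 0 - dw A (dwbar J (s I A)) 0) := by
    simp only [dbarStar12, hg.chern_zero, zero_mul, Finset.sum_const_zero, sub_zero]
    rw [hg.sum_inv fun A B => dw A (dbar11 s B I J) 0 - dw A (dbar11 s J I B) 0]
    rfl
  rw [dbarLaplacian, h1, h3]
  simp only [Finset.sum_sub_distrib]
  ring

end KNormalAt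

end NormalKahler

variable {m n : ℕ}

/-- Square matrices on `ℂ^{n+m}`. -/
abbrev AmbMat (m n : ℕ) : Type := Matrix (Fin m ⊕ Fin n) (Fin m ⊕ Fin n) ℂ

/-! ### The block matrices of a chart -/

section Blocks

variable (W : Matrix (Fin n) (Fin m) ℂ)

/-- The basis `(I; W)` of the plane with chart coordinates `W`. -/
def colU (W : Matrix (Fin n) (Fin m) ℂ) : Matrix (Fin m ⊕ Fin n) (Fin m) ℂ := Matrix.fromRows 1 W

/-- The basis `(-W*; I)` of its orthogonal complement. -/
def colV (W : Matrix (Fin n) (Fin m) ℂ) : Matrix (Fin m ⊕ Fin n) (Fin n) ℂ :=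
  Matrix.fromRows (-Wᴴ) 1

/-- The Gram matrix of `(I; W)`. -/
def gramU (W : Matrix (Fin n) (Fin m) ℂ) : Matrix (Fin m) (Fin m) ℂ := 1 + Wᴴ * W

/-- The Gram matrix of `(-W*; I)`. -/
def gramV (W : Matrix (Fin n) (Fin m) ℂ) : Matrix (Fin n) (Fin n) ℂ := 1 + W * Wᴴ

open scoped ComplexOrder in
theorem isUnit_det_gramU : IsUnit (gramU W).det :=
  (Matrix.isUnit_iff_isUnit_det _).1
    (Matrix.PosDef.one.add_posSemidef (Matrix.posSemidef_conjTranspose_mul_self W)).isUnit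

open scoped ComplexOrder in
theorem isUnit_det_gramV : IsUnit (gramV W).det :=
  (Matrix.isUnit_iff_isUnit_det _).1
    (Matrix.PosDef.one.add_posSemidef (Matrix.posSemidef_self_mul_conjTranspose W)).isUnit

theorem gramU_isHermitian : (gramU W)ᴴ = gramU W := by simp [gramU]

theorem gramV_isHermitian : (gramV W)ᴴ = gramV W := by simp [gramV]

theorem colU_gram : (colU W)ᴴ * colU W = gramU W := by
  simp [colU, gramU, Matrix.conjTranspose_fromRows_eq_fromCols_conjTranspose,
    Matrix.fromCols_mul_fromRows]

theorem gramV_inv_mul : (gramV W)⁻¹ * W = W * (gramU W)⁻¹ := by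
  have h : W * gramU W = gramV W * W := by
    simp [gramU, gramV, Matrix.mul_add, Matrix.add_mul, Matrix.mul_assoc]
  calc (gramV W)⁻¹ * W = (gramV W)⁻¹ * (W * gramU W) * (gramU W)⁻¹ := by
        rw [Matrix.mul_assoc, Matrix.mul_assoc, Matrix.mul_nonsing_inv _ (isUnit_det_gramU W),
          Matrix.mul_one]
    _ = W * (gramU W)⁻¹ := by
        rw [h, ← Matrix.mul_assoc, Matrix.nonsing_inv_mul _ (isUnit_det_gramV W), Matrix.one_mul]

theorem gramU_inv_mul : (gramU W)⁻¹ * Wᴴ = Wᴴ * (gramV W)⁻¹ := by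
  have h := congrArg Matrix.conjTranspose (gramV_inv_mul W)
  simpa [Matrix.conjTranspose_nonsing_inv, gramU_isHermitian, gramV_isHermitian] using h.symm

/-- The orthogonal projection to the plane with coordinates `W`. -/
def projU (W : Matrix (Fin n) (Fin m) ℂ) : AmbMat m n := colU W * (gramU W)⁻¹ * (colU W)ᴴ

/-- The orthogonal projection to its complement. -/
def projV (W : Matrix (Fin n) (Fin m) ℂ) : AmbMat m n := colV W * (gramV W)⁻¹ * (colV W)ᴴ

theorem projU_add_projV : projU W + projV W = 1 := by
  have h1 : (gramU W)⁻¹ + Wᴴ * (gramV W)⁻¹ * W = 1 := by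
    rw [Matrix.mul_assoc, gramV_inv_mul, ← Matrix.mul_assoc]
    nth_rewrite 1 [← Matrix.one_mul (gramU W)⁻¹]
    rw [← Matrix.add_mul]
    exact Matrix.mul_nonsing_inv _ (isUnit_det_gramU W)
  have h2 : W * (gramU W)⁻¹ * Wᴴ + (gramV W)⁻¹ = 1 := by
    rw [Matrix.mul_assoc, gramU_inv_mul, ← Matrix.mul_assoc, add_comm]
    nth_rewrite 1 [← Matrix.one_mul (gramV W)⁻¹]
    rw [← Matrix.add_mul]
    exact Matrix.mul_nonsing_inv _ (isUnit_det_gramV W)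
  have h3 : (gramU W)⁻¹ * Wᴴ + -(Wᴴ * (gramV W)⁻¹) = 0 := by rw [gramU_inv_mul]; simp
  have h4 : W * (gramU W)⁻¹ + -((gramV W)⁻¹ * W) = 0 := by rw [gramV_inv_mul]; simp
  rw [projU, projV, colU, colV]
  simp only [Matrix.conjTranspose_fromRows_eq_fromCols_conjTranspose, Matrix.fromRows_mul,
    Matrix.mul_fromCols, Matrix.fromCols_fromRows_eq_fromBlocks, Matrix.fromBlocks_add,
    Matrix.one_mul, Matrix.mul_one, Matrix.conjTranspose_one, Matrix.conjTranspose_neg,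
    Matrix.conjTranspose_conjTranspose, Matrix.neg_mul, Matrix.mul_neg, Matrix.fromRows_neg, neg_neg, h1, h2, h3, h4,
    Matrix.fromBlocks_one]

theorem projV_isHermitian : (projV W)ᴴ = projV W := by
  simp [projV, Matrix.conjTranspose_nonsing_inv, gramV_isHermitian, Matrix.mul_assoc]

end Blocks

/-! ### Tensor fields in a chart -/

section Planes

variable (A : Frame m n) (W : Matrix (Fin n) (Fin m) ℂ)

theorem frame_star_mul (A : Frame m n) : (A : AmbMat m n)ᴴ * (A : AmbMat m n) = 1 :=
  Matrix.UnitaryGroup.star_mul_self A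

theorem frame_mul_star (A : Frame m n) : (A : AmbMat m n) * (A : AmbMat m n)ᴴ = 1 :=
  mul_eq_one_comm.1 (frame_star_mul A)

theorem frame_star_mul_cancel (A : Frame m n) {p : Type*} (B : Matrix (Fin m ⊕ Fin n) p ℂ) :
    (A : AmbMat m n)ᴴ * ((A : AmbMat m n) * B) = B := by
  rw [← Matrix.mul_assoc, frame_star_mul, Matrix.one_mul]

theorem chart_starProjection (v : Amb m n) :
    (chart A W).1.starProjection v =
      Matrix.toEuclideanLin ((A : AmbMat m n) * projU W * (A : AmbMat m n)ᴴ) v := by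
  refine Submodule.eq_starProjection_of_mem_of_inner_eq_zero (K := (chart A W).1) ?_ ?_
  · refine ⟨Matrix.toEuclideanLin ((gramU W)⁻¹ * (colU W)ᴴ * (A : AmbMat m n)ᴴ) v, ?_⟩
    apply WithLp.ofLp_injective
    simp [Matrix.toLpLin_apply, projU, colU, Matrix.mul_assoc]
  · rintro _ ⟨z, rfl⟩
    rw [← LinearMap.adjoint_inner_left, ← Matrix.toEuclideanLin_conjTranspose_eq_adjoint]
    have h : (((A : AmbMat m n) * Matrix.fromRows (1 : Matrix (Fin m) (Fin m) ℂ) W)ᴴ *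
        ((A : AmbMat m n) * projU W * (A : AmbMat m n)ᴴ)) =
        ((A : AmbMat m n) * Matrix.fromRows (1 : Matrix (Fin m) (Fin m) ℂ) W)ᴴ := by
      change ((A : AmbMat m n) * colU W)ᴴ * _ = ((A : AmbMat m n) * colU W)ᴴ
      rw [Matrix.conjTranspose_mul, Matrix.mul_assoc, Matrix.mul_assoc, frame_star_mul_cancel, projU,
        ← Matrix.mul_assoc, Matrix.mul_assoc _ _ (colU W)ᴴ, ← Matrix.mul_assoc (colU W)ᴴ,
        colU_gram, ← Matrix.mul_assoc, Matrix.mul_nonsing_inv _ (isUnit_det_gramU W),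
        Matrix.one_mul]
    have h' : Matrix.toEuclideanLin (((A : AmbMat m n) * Matrix.fromRows (1 : Matrix (Fin m) (Fin m) ℂ) W)ᴴ)
        (v - Matrix.toEuclideanLin ((A : AmbMat m n) * projU W * (A : AmbMat m n)ᴴ) v) = 0 := by
      rw [map_sub]
      nth_rewrite 1 [← h]
      rw [sub_eq_zero]
      apply WithLp.ofLp_injective
      simp [Matrix.toLpLin_apply]
    rw [h', inner_zero_left]

theorem inner_toEuclideanLin_left {p q : Type*} [Fintype p] [DecidableEq p] [Fintype q]
    [DecidableEq q] (M : Matrix p q ℂ) (x : EuclideanSpace ℂ q) (y : EuclideanSpace ℂ p) :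
    inner ℂ (Matrix.toEuclideanLin M x) y = inner ℂ x (Matrix.toEuclideanLin Mᴴ y) := by
  rw [Matrix.toEuclideanLin_conjTranspose_eq_adjoint, LinearMap.adjoint_inner_right]

theorem toEuclideanLin_mul_apply (M L : AmbMat m n) (x : Amb m n) :
    Matrix.toEuclideanLin (M * L) x = Matrix.toEuclideanLin M (Matrix.toEuclideanLin L x) := by
  apply WithLp.ofLp_injective
  simp [Matrix.toLpLin_apply]

theorem trace_eq_sum_inner (M : AmbMat m n) : M.trace =
    ∑ k, inner ℂ (EuclideanSpace.basisFun (Fin m ⊕ Fin n) ℂ k)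
      (Matrix.toEuclideanLin M (EuclideanSpace.basisFun (Fin m ⊕ Fin n) ℂ k)) := by
  simp [Matrix.trace, Matrix.toLpLin_apply, EuclideanSpace.inner_single_left, -Fintype.sum_sum_type]

section Basis

variable {κ : Type*} [Fintype κ] {U : Submodule ℂ (Amb m n)} (e : OrthonormalBasis κ ℂ U)

theorem sum_inner_smul (y : Amb m n) : ∑ j, inner ℂ (e j : Amb m n) y • (e j : Amb m n) =
    U.starProjection y := by
  rw [e.starProjection_eq_sum_rankOne]
  simp [InnerProductSpace.rankOne_apply]

theorem sum_inner_mul (x y : Amb m n) : ∑ j, inner ℂ x (e j : Amb m n) * inner ℂ (e j : Amb m n) y =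
    inner ℂ x (U.starProjection y) := by
  rw [← sum_inner_smul e y, inner_sum]
  simp [inner_smul_right, mul_comm]

/-- The trace over a subspace of the compression of `T` is the trace of `T P`, with `P` the
orthogonal projection. -/
theorem sum_inner_eq_trace {P : AmbMat m n}
    (hP : ∀ v, U.starProjection v = Matrix.toEuclideanLin P v) (T : AmbMat m n) :
    ∑ i, inner ℂ (e i : Amb m n) (Matrix.toEuclideanLin T (e i : Amb m n)) = (T * P).trace := by
  rw [trace_eq_sum_inner]
  simp only [toEuclideanLin_mul_apply, ← hP, ← sum_inner_smul e, map_sum, map_smul, inner_sum,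
    inner_smul_right]
  rw [Finset.sum_comm]
  refine Finset.sum_congr rfl fun i _ => ?_
  exact (OrthonormalBasis.sum_inner_mul_inner _ _ _).symm

end Basis

/-- The matrix `A [[0, 0], [X, 0]] A⁻¹`. -/
def lift (A : Frame m n) (X : Matrix (Fin n) (Fin m) ℂ) : AmbMat m n :=
  (A : AmbMat m n) * Matrix.fromBlocks 0 0 X 0 * (A : AmbMat m n)ᴴ

/-- The orthogonal projection to the plane `chart A W`. -/
def planeProj (A : Frame m n) (W : Matrix (Fin n) (Fin m) ℂ) : AmbMat m n :=
  (A : AmbMat m n) * projU W * (A : AmbMat m n)ᴴ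

/-- The orthogonal projection to the complement of `chart A W`. -/
def perpProj (A : Frame m n) (W : Matrix (Fin n) (Fin m) ℂ) : AmbMat m n :=
  (A : AmbMat m n) * projV W * (A : AmbMat m n)ᴴ

theorem planeProj_add_perpProj : planeProj A W + perpProj A W = 1 := by
  rw [planeProj, perpProj, ← Matrix.add_mul, ← Matrix.mul_add, projU_add_projV, Matrix.mul_one,
    frame_mul_star]

theorem perpProj_isHermitian : (perpProj A W)ᴴ = perpProj A W := by
  simp [perpProj, projV_isHermitian, Matrix.mul_assoc]

theorem velocity_apply (X : Matrix (Fin n) (Fin m) ℂ) (u : (chart A W).1) :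
    (velocity A W X u : Amb m n) = Matrix.toEuclideanLin (perpProj A W * lift A X) u := by
  have h1 : perpProj A W = 1 - planeProj A W := by
    rw [← planeProj_add_perpProj A W, add_sub_cancel_left]
  have h2 : (velocity A W X u : Amb m n) =
      (chart A W).1ᗮ.starProjection (Matrix.toEuclideanLin (lift A X) u) := rfl
  rw [h2, Submodule.starProjection_orthogonal_val, chart_starProjection, h1, Matrix.sub_mul,
    Matrix.one_mul, map_sub, LinearMap.sub_apply, toEuclideanLin_mul_apply (planeProj A W)]
  rfl

theorem sharp_coord {U : Submodule ℂ (Amb m n)} (i : Fin (Module.finrank ℂ U)) :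
    sharp ((stdOrthonormalBasis ℂ U).toBasis.coord i) = stdOrthonormalBasis ℂ U i := by
  rw [sharp, LinearIsometryEquiv.symm_apply_eq]
  ext v
  simp [OrthonormalBasis.repr_apply_apply]

/-- The product of the forms induced by `α` on `U*` and by `β` on `U^⊥`, evaluated on velocities,
as a trace over the ambient space; this removes the auxiliary orthonormal basis. -/
theorem prodForm_velocity (α β : AmbMat m n) (X Y : Matrix (Fin n) (Fin m) ℂ) :
    prodForm (dualForm (restr (sesq α) (chart A W).1)) (restr (sesq β) ((chart A W).1)ᗮ)
      (velocity A W X) (velocity A W Y) =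
    (α * planeProj A W * ((lift A Y)ᴴ * (perpProj A W * β * perpProj A W) * lift A X) *
      planeProj A W).trace := by
  have h1 : prodForm (dualForm (restr (sesq α) (chart A W).1))
      (restr (sesq β) ((chart A W).1)ᗮ) (velocity A W X) (velocity A W Y) =
      ∑ i, ∑ j, inner ℂ (stdOrthonormalBasis ℂ (chart A W).1 i : Amb m n)
        (Matrix.toEuclideanLin α (stdOrthonormalBasis ℂ (chart A W).1 j : Amb m n)) *
        inner ℂ (velocity A W Y (stdOrthonormalBasis ℂ (chart A W).1 j) : Amb m n)
        (Matrix.toEuclideanLin β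
          (velocity A W X (stdOrthonormalBasis ℂ (chart A W).1 i) : Amb m n)) := by
    simp only [prodForm, LinearMap.mk₂'ₛₗ_apply, dualForm, sharp_coord, restr, sesq]
  have h2 : ∀ u v : Amb m n, inner ℂ (Matrix.toEuclideanLin (perpProj A W * lift A Y) v)
      (Matrix.toEuclideanLin β (Matrix.toEuclideanLin (perpProj A W * lift A X) u)) =
      inner ℂ v (Matrix.toEuclideanLin
        ((lift A Y)ᴴ * (perpProj A W * β * perpProj A W) * lift A X) u) := by
    intro u v
    rw [inner_toEuclideanLin_left, ← toEuclideanLin_mul_apply, ← toEuclideanLin_mul_apply,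
      Matrix.conjTranspose_mul, perpProj_isHermitian]
    simp only [Matrix.mul_assoc]
  have h3 : ∀ u v : Amb m n, inner ℂ u (Matrix.toEuclideanLin α v) =
      inner ℂ (Matrix.toEuclideanLin αᴴ u) v := by
    intro u v
    rw [inner_toEuclideanLin_left, Matrix.conjTranspose_conjTranspose]
  rw [h1]
  simp only [velocity_apply, h2, h3, sum_inner_mul]
  simp only [chart_starProjection, inner_toEuclideanLin_left, Matrix.conjTranspose_conjTranspose,
    ← toEuclideanLin_mul_apply]
  rw [sum_inner_eq_trace _ (chart_starProjection A W)]
  simp only [planeProj, Matrix.mul_assoc]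

/-- The matrix `(E*E)⁻¹ E*αE (E*E)⁻¹` for the basis `E` of the plane: the form induced by `α` on
the dual of the tautological bundle. -/
def formU (α : AmbMat m n) (W : Matrix (Fin n) (Fin m) ℂ) : Matrix (Fin m) (Fin m) ℂ :=
  (gramU W)⁻¹ * ((colU W)ᴴ * α * colU W) * (gramU W)⁻¹

/-- The matrix `(F*F)⁻¹ F*βF (F*F)⁻¹` for the basis `F` of the complement. -/
def formV (β : AmbMat m n) (W : Matrix (Fin n) (Fin m) ℂ) : Matrix (Fin n) (Fin n) ℂ :=
  (gramV W)⁻¹ * ((colV W)ᴴ * β * colV W) * (gramV W)⁻¹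

/-- The matrix of the form `α` in the frame `A`. -/
def inFrame (A : Frame m n) (α : AmbMat m n) : AmbMat m n := (A : AmbMat m n)ᴴ * α * (A : AmbMat m n)

theorem colV_block_colU (X : Matrix (Fin n) (Fin m) ℂ) :
    (colV W)ᴴ * ((Matrix.fromBlocks 0 0 X 0 : AmbMat m n) * colU W) = X := by
  simp [colV, colU, Matrix.conjTranspose_fromRows_eq_fromCols_conjTranspose,
    Matrix.fromBlocks_mul_fromRows, Matrix.fromCols_mul_fromRows]

/-- The components of the product of the forms induced by `α` and `β`; moving the frame `A` to the
standard one replaces `α` by `A* α A`. -/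
theorem prodForm_chart (α β : AmbMat m n) (X Y : Matrix (Fin n) (Fin m) ℂ) :
    prodForm (dualForm (restr (sesq α) (chart A W).1)) (restr (sesq β) ((chart A W).1)ᗮ)
      (velocity A W X) (velocity A W Y) =
    (formU (inFrame A α) W * Yᴴ * formV (inFrame A β) W * X).trace := by
  rw [prodForm_velocity]
  have hX := colV_block_colU W X
  have hY : (colU W)ᴴ * ((Matrix.fromBlocks 0 0 Y 0 : AmbMat m n)ᴴ * colV W) = Yᴴ := by
    have h := congrArg Matrix.conjTranspose (colV_block_colU W Y)
    simpa only [Matrix.conjTranspose_mul, Matrix.conjTranspose_conjTranspose, Matrix.mul_assoc]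
      using h
  have hl : α * planeProj A W * ((lift A Y)ᴴ * (perpProj A W * β * perpProj A W) * lift A X) *
      planeProj A W = (α * (A : AmbMat m n) * colU W * (gramU W)⁻¹ *
        ((colU W)ᴴ * ((Matrix.fromBlocks 0 0 Y 0 : AmbMat m n)ᴴ * colV W)) * formV (inFrame A β) W *
        ((colV W)ᴴ * ((Matrix.fromBlocks 0 0 X 0 : AmbMat m n) * colU W)) * (gramU W)⁻¹ * (colU W)ᴴ) *
        (A : AmbMat m n)ᴴ := by
    simp only [planeProj, perpProj, lift, projU, projV, formV, inFrame, Matrix.conjTranspose_mul,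
      Matrix.conjTranspose_conjTranspose, Matrix.mul_assoc, frame_star_mul_cancel]
  rw [hl, hX, hY, Matrix.trace_mul_comm]
  have hr : formU (inFrame A α) W * Yᴴ * formV (inFrame A β) W * X = ((gramU W)⁻¹ * (colU W)ᴴ) *
      ((A : AmbMat m n)ᴴ * (α * (A : AmbMat m n) * colU W * (gramU W)⁻¹ * Yᴴ *
        formV (inFrame A β) W * X)) := by
    simp only [formU, inFrame, Matrix.mul_assoc]
  rw [hr, Matrix.trace_mul_comm ((gramU W)⁻¹ * (colU W)ᴴ)]
  simp only [Matrix.mul_assoc]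

theorem fγ_chart (γ : AmbMat m n) : fγ γ (chart A W) =
    ((gramU W)⁻¹ * ((colU W)ᴴ * inFrame A γ * colU W)).trace := by
  have h : fγ γ (chart A W) = ∑ i, inner ℂ (stdOrthonormalBasis ℂ (chart A W).1 i : Amb m n)
      (Matrix.toEuclideanLin γ (stdOrthonormalBasis ℂ (chart A W).1 i : Amb m n)) := by
    simp only [fγ, restr, sesq, LinearMap.mk₂'ₛₗ_apply]
  rw [h, sum_inner_eq_trace _ (chart_starProjection A W)]
  have h2 : γ * ((A : AmbMat m n) * projU W * (A : AmbMat m n)ᴴ) =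
      (γ * ((A : AmbMat m n) * colU W)) * ((gramU W)⁻¹ * ((colU W)ᴴ * (A : AmbMat m n)ᴴ)) := by
    simp only [projU, Matrix.mul_assoc]
  rw [h2, Matrix.trace_mul_comm]
  simp only [inFrame, Matrix.mul_assoc]

theorem inFrame_one : inFrame A 1 = 1 := by
  rw [inFrame, Matrix.mul_one, frame_star_mul]

theorem trace_inFrame (γ : AmbMat m n) : (inFrame A γ).trace = γ.trace := by
  rw [inFrame, Matrix.trace_mul_comm, ← Matrix.mul_assoc, frame_mul_star, Matrix.one_mul]

end Planes

/-! ### Jets of matrix expressions -/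

section JetArith

variable {ι : Type*} [Fintype ι] [DecidableEq ι]

theorem Jet2.const_mul {u : (ι → ℝ) → ℂ} {c : ℂ} {l : ι → ℂ} {q : ι → ι → ℂ} (k : ℂ)
    (hu : Jet2 u c l q) :
    Jet2 (fun x => k * u x) (k * c) (fun a => k * l a) (fun a b => k * q a b) :=
  ((Jet2.const k).mul hu).congr rfl (by simp) (by simp)

theorem MatJet.neg {p q : Type*} {u : (ι → ℝ) → Matrix p q ℂ} {c : Matrix p q ℂ}
    {l : ι → Matrix p q ℂ} {s : ι → ι → Matrix p q ℂ} (hu : MatJet u c l s) :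
    MatJet (fun x => -u x) (-c) (fun a => -l a) (fun a b => -s a b) :=
  fun i j => (hu i j).clm (-ContinuousLinearMap.id ℝ ℂ)

theorem MatJet.of_smooth {p q : Type*} {u : (ι → ℝ) → Matrix p q ℂ}
    (h : ∀ i j, ContDiff ℝ ∞ fun x => u x i j) :
    MatJet u (u 0) (fun a => Matrix.of fun i j => pd a (fun x => u x i j) 0)
      (fun a b => Matrix.of fun i j => pd a (pd b fun x => u x i j) 0) :=
  fun i j => ⟨h i j, rfl, fun _ => rfl, fun _ _ => rfl⟩

/-- The jet of `(1 + v)⁻¹` for `v` vanishing to second order, from `(1 + v)⁻¹ = 1 - v (1 + v)⁻¹`. -/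
theorem MatJet.inv_one_add {p : Type*} [Fintype p] [DecidableEq p] {v : (ι → ℝ) → Matrix p p ℂ}
    {s : ι → ι → Matrix p p ℂ} (hv : MatJet v 0 (fun _ => 0) s)
    (hd : ∀ x, IsUnit (1 + v x).det) :
    MatJet (fun x => (1 + v x)⁻¹) 1 (fun _ => 0) (fun a b => -s a b) := by
  have h1 : MatJet (fun x => 1 + v x) _ _ _ := (MatJet.const 1).add hv
  have h2 := MatJet.of_smooth (u := fun x => (1 + v x)⁻¹)
    (contDiff_inv_entry (fun i j => (h1 i j).smooth) fun x => (hd x).ne_zero)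
  have h0 : (1 + v 0)⁻¹ = 1 := by
    have : v 0 = 0 := by ext i j; exact (hv i j).val
    simp [this]
  -- only the value of the inverse at the origin enters the jet of the right-hand side
  have h3 := (MatJet.const 1).add (hv.mul h2).neg
  have he : (fun x => (1 : Matrix p p ℂ) + -(v x * (1 + v x)⁻¹)) = fun x => (1 + v x)⁻¹ := by
    funext x
    have := Matrix.mul_nonsing_inv _ (hd x)
    rw [Matrix.add_mul, Matrix.one_mul] at this
    nth_rewrite 1 [← this]
    abel
  rw [he] at h3
  exact h3.congr (by simp) (by simp) (by simp [h0])

end JetArith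

/-! ### Jets of the metric and of the tensors attached to a Hermitian matrix -/

section FieldJets

/-- The coordinate vector `∂/∂x_a` of a chart, as a matrix. -/
def coordMat (a : Idx m n) : Matrix (Fin n) (Fin m) ℂ := toW (Pi.single a 1)

/-- The coordinate vector `∂/∂w_I` of a chart, as a matrix. -/
def unitMat (I : Fin n × Fin m) : Matrix (Fin n) (Fin m) ℂ := Matrix.single I.1 I.2 1

theorem coordMat_zero (I : Fin n × Fin m) : coordMat (I, 0) = unitMat I := by
  ext i j
  simp [coordMat, unitMat, toW, Pi.single_apply, Matrix.single_apply, Prod.ext_iff, eq_comm]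
  split_ifs <;> simp

theorem coordMat_one (I : Fin n × Fin m) : coordMat (I, 1) = Complex.I • unitMat I := by
  ext i j
  simp [coordMat, unitMat, toW, Pi.single_apply, Matrix.single_apply, Prod.ext_iff, eq_comm]
  split_ifs <;> simp

/-- The entry `w_{ij}` as a linear function of the real coordinates. -/
def toWCLM (i : Fin n) (j : Fin m) : (Idx m n → ℝ) →L[ℝ] ℂ :=
  Complex.ofRealCLM ∘L ContinuousLinearMap.proj ((i, j), 0) +
    ContinuousLinearMap.smulRight
      (ContinuousLinearMap.proj (R := ℝ) (φ := fun _ : Idx m n => ℝ) ((i, j), 1)) Complex.I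

theorem toWCLM_apply (i : Fin n) (j : Fin m) (x : Idx m n → ℝ) : toWCLM i j x = toW x i j := by
  simp [toWCLM, toW]

theorem jet_linear {ι F : Type*} [Fintype ι] [DecidableEq ι] [NormedAddCommGroup F]
    [NormedSpace ℝ F] (T : (ι → ℝ) →L[ℝ] F) :
    Jet2 (fun x => T x) 0 (fun a => T (Pi.single a 1)) (fun _ _ => 0) := by
  have h : ∀ a x, pd a (fun x => T x) x = T (Pi.single a 1) := fun a x => by simp [pd]
  refine ⟨T.contDiff, map_zero T, fun a => h a 0, fun a b => ?_⟩
  rw [funext (h b), pd_const]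

theorem toW_jet : MatJet (fun x : Idx m n → ℝ => toW x) 0 coordMat (fun _ _ => 0) := by
  intro i j
  have h := jet_linear (toWCLM (m := m) i j)
  simp only [toWCLM_apply] at h
  exact h

theorem toW_conj_jet :
    MatJet (fun x : Idx m n → ℝ => (toW x)ᴴ) 0 (fun a => (coordMat a)ᴴ) (fun _ _ => 0) := by
  intro i j
  have h := (toW_jet (m := m) j i).clm (Complex.conjCLE : ℂ →L[ℝ] ℂ)
  exact h.congr (map_zero _) (fun a => rfl) (fun a b => map_zero _)

theorem gramU_inv_jet : MatJet (fun x : Idx m n → ℝ => (gramU (toW x))⁻¹) 1 (fun _ => 0)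
    (fun a b => -((coordMat a)ᴴ * coordMat b + (coordMat b)ᴴ * coordMat a)) := by
  refine MatJet.inv_one_add ((toW_conj_jet.mul toW_jet).congr ?_ ?_ ?_)
    (fun x => isUnit_det_gramU (toW x)) <;> simp

theorem gramV_inv_jet : MatJet (fun x : Idx m n → ℝ => (gramV (toW x))⁻¹) 1 (fun _ => 0)
    (fun a b => -(coordMat a * (coordMat b)ᴴ + coordMat b * (coordMat a)ᴴ)) := by
  refine MatJet.inv_one_add ((toW_jet.mul toW_conj_jet).congr ?_ ?_ ?_)
    (fun x => isUnit_det_gramV (toW x)) <;> simp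

section Blocks

variable (α : AmbMat m n)

theorem compressU_eq (W : Matrix (Fin n) (Fin m) ℂ) : (colU W)ᴴ * α * colU W =
    α.toBlocks₁₁ + (α.toBlocks₁₂ * W + Wᴴ * α.toBlocks₂₁) + Wᴴ * α.toBlocks₂₂ * W := by
  conv_lhs => rw [← Matrix.fromBlocks_toBlocks α]
  simp only [colU, Matrix.conjTranspose_fromRows_eq_fromCols_conjTranspose, Matrix.mul_assoc,
    Matrix.fromBlocks_mul_fromRows, Matrix.fromCols_mul_fromRows, Matrix.conjTranspose_one,
    Matrix.one_mul, Matrix.mul_one, Matrix.mul_add]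
  abel

theorem compressV_eq (W : Matrix (Fin n) (Fin m) ℂ) : (colV W)ᴴ * α * colV W =
    α.toBlocks₂₂ + -(W * α.toBlocks₁₂ + α.toBlocks₂₁ * Wᴴ) + W * α.toBlocks₁₁ * Wᴴ := by
  conv_lhs => rw [← Matrix.fromBlocks_toBlocks α]
  simp only [colV, Matrix.conjTranspose_fromRows_eq_fromCols_conjTranspose, Matrix.mul_assoc,
    Matrix.fromBlocks_mul_fromRows, Matrix.fromCols_mul_fromRows, Matrix.conjTranspose_one,
    Matrix.one_mul, Matrix.mul_one, Matrix.mul_add, Matrix.conjTranspose_neg, Matrix.mul_neg,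
    Matrix.neg_mul, Matrix.conjTranspose_conjTranspose]
  simp only [neg_neg]
  abel

theorem compressU_jet : MatJet (fun x : Idx m n → ℝ => (colU (toW x))ᴴ * α * colU (toW x))
    α.toBlocks₁₁ (fun a => α.toBlocks₁₂ * coordMat a + (coordMat a)ᴴ * α.toBlocks₂₁)
    (fun a b => (coordMat a)ᴴ * α.toBlocks₂₂ * coordMat b +
      (coordMat b)ᴴ * α.toBlocks₂₂ * coordMat a) := by
  simp only [compressU_eq]
  refine (((MatJet.const _).add (((MatJet.const _).mul toW_jet).add
    (toW_conj_jet.mul (MatJet.const _)))).add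
    ((toW_conj_jet.mul (MatJet.const _)).mul toW_jet)).congr ?_ ?_ ?_ <;> simp

theorem compressV_jet : MatJet (fun x : Idx m n → ℝ => (colV (toW x))ᴴ * α * colV (toW x))
    α.toBlocks₂₂ (fun a => -(coordMat a * α.toBlocks₁₂ + α.toBlocks₂₁ * (coordMat a)ᴴ))
    (fun a b => coordMat a * α.toBlocks₁₁ * (coordMat b)ᴴ +
      coordMat b * α.toBlocks₁₁ * (coordMat a)ᴴ) := by
  simp only [compressV_eq]
  refine (((MatJet.const _).add (((toW_jet.mul (MatJet.const _)).add
    ((MatJet.const _).mul toW_conj_jet)).neg)).add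
    ((toW_jet.mul (MatJet.const _)).mul toW_conj_jet)).congr ?_ ?_ ?_ <;> simp

/-- The second-order part of `formU` in the directions `P` (conjugate linear) and `Q`. -/
def formU₂ (P Q : Matrix (Fin n) (Fin m) ℂ) : Matrix (Fin m) (Fin m) ℂ :=
  Pᴴ * α.toBlocks₂₂ * Q - Pᴴ * Q * α.toBlocks₁₁ - α.toBlocks₁₁ * (Pᴴ * Q)

/-- The second-order part of `formV` in the directions `P` (conjugate linear) and `Q`. -/
def formV₂ (P Q : Matrix (Fin n) (Fin m) ℂ) : Matrix (Fin n) (Fin n) ℂ :=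
  Q * α.toBlocks₁₁ * Pᴴ - Q * Pᴴ * α.toBlocks₂₂ - α.toBlocks₂₂ * (Q * Pᴴ)

theorem formU_jet : MatJet (fun x : Idx m n → ℝ => formU α (toW x)) α.toBlocks₁₁
    (fun a => α.toBlocks₁₂ * coordMat a + (coordMat a)ᴴ * α.toBlocks₂₁)
    (fun a b => formU₂ α (coordMat a) (coordMat b) + formU₂ α (coordMat b) (coordMat a)) := by
  refine ((gramU_inv_jet.mul (compressU_jet α)).mul gramU_inv_jet).congr (by simp) (by simp) ?_
  intro a b
  simp only [formU₂, Matrix.mul_one, Matrix.one_mul, Matrix.zero_mul, Matrix.mul_zero, add_zero,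
    zero_add, Matrix.neg_mul, Matrix.mul_neg, Matrix.add_mul, Matrix.mul_add]
  abel

theorem formV_jet : MatJet (fun x : Idx m n → ℝ => formV α (toW x)) α.toBlocks₂₂
    (fun a => -(coordMat a * α.toBlocks₁₂ + α.toBlocks₂₁ * (coordMat a)ᴴ))
    (fun a b => formV₂ α (coordMat a) (coordMat b) + formV₂ α (coordMat b) (coordMat a)) := by
  refine ((gramV_inv_jet.mul (compressV_jet α)).mul gramV_inv_jet).congr (by simp) (by simp) ?_
  intro a b
  simp only [formV₂, Matrix.mul_one, Matrix.one_mul, Matrix.zero_mul, Matrix.mul_zero, add_zero,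
    zero_add, Matrix.neg_mul, Matrix.mul_neg, Matrix.add_mul, Matrix.mul_add]
  abel

theorem traceU_jet : Jet2 (fun x : Idx m n → ℝ =>
      ((gramU (toW x))⁻¹ * ((colU (toW x))ᴴ * α * colU (toW x))).trace) α.toBlocks₁₁.trace
    (fun a => (α.toBlocks₁₂ * coordMat a + (coordMat a)ᴴ * α.toBlocks₂₁).trace)
    (fun a b => ((coordMat a)ᴴ * α.toBlocks₂₂ * coordMat b
        - (coordMat a)ᴴ * coordMat b * α.toBlocks₁₁).trace +
      ((coordMat b)ᴴ * α.toBlocks₂₂ * coordMat a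
        - (coordMat b)ᴴ * coordMat a * α.toBlocks₁₁).trace) := by
  refine (gramU_inv_jet.mul (compressU_jet α)).trace.congr (by simp) (by simp) ?_
  intro a b
  rw [← Matrix.trace_add]
  congr 1
  simp only [Matrix.one_mul, Matrix.zero_mul, add_zero, Matrix.neg_mul, Matrix.add_mul,
    Matrix.mul_add]
  abel

end Blocks

/-- The form `tr(P* t Q s)`, linear in `Q` and conjugate linear in `P`. -/
def contr (t : Matrix (Fin n) (Fin n) ℂ) (s : Matrix (Fin m) (Fin m) ℂ)
    (P Q : Matrix (Fin n) (Fin m) ℂ) : ℂ := (Pᴴ * t * Q * s).trace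

/-- The 2-jet at the centre of the chart of `A` of a field of sesquilinear forms, evaluated on
constant vectors `X`, `Y`: the value is `h0 X Y`, the first derivative in the direction `P` is
`l P X Y`, and the second derivative in the directions `P`, `Q` is `Φ P Q X Y + Φ Q P X Y`. -/
def FieldJet (h : SesqField m n) (A : Frame m n)
    (h0 : Matrix (Fin n) (Fin m) ℂ → Matrix (Fin n) (Fin m) ℂ → ℂ)
    (l : Matrix (Fin n) (Fin m) ℂ → Matrix (Fin n) (Fin m) ℂ → Matrix (Fin n) (Fin m) ℂ → ℂ)
    (Φ : Matrix (Fin n) (Fin m) ℂ → Matrix (Fin n) (Fin m) ℂ → Matrix (Fin n) (Fin m) ℂ →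
      Matrix (Fin n) (Fin m) ℂ → ℂ) : Prop :=
  ∀ X Y, Jet2 (fun x : Idx m n → ℝ =>
      h (chart A (toW x)) (velocity A (toW x) X) (velocity A (toW x) Y))
    (h0 X Y) (fun a => l (coordMat a) X Y)
    (fun a b => Φ (coordMat a) (coordMat b) X Y + Φ (coordMat b) (coordMat a) X Y)

section One

theorem toBlocks₁₁_one : (1 : AmbMat m n).toBlocks₁₁ = 1 := by
  rw [← Matrix.fromBlocks_one, Matrix.toBlocks_fromBlocks₁₁]

theorem toBlocks₂₂_one : (1 : AmbMat m n).toBlocks₂₂ = 1 := by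
  rw [← Matrix.fromBlocks_one, Matrix.toBlocks_fromBlocks₂₂]

theorem toBlocks₁₂_one : (1 : AmbMat m n).toBlocks₁₂ = 0 := by
  rw [← Matrix.fromBlocks_one, Matrix.toBlocks_fromBlocks₁₂]

theorem toBlocks₂₁_one : (1 : AmbMat m n).toBlocks₂₁ = 0 := by
  rw [← Matrix.fromBlocks_one, Matrix.toBlocks_fromBlocks₂₁]

end One

theorem trace_formU₂_mul (α : AmbMat m n) (P Q : Matrix (Fin n) (Fin m) ℂ)
    (Z : Matrix (Fin m) (Fin m) ℂ) : (formU₂ α P Q * Z).trace =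
      contr α.toBlocks₂₂ Z P Q - contr 1 (α.toBlocks₁₁ * Z) P Q - contr 1 (Z * α.toBlocks₁₁) P Q := by
  have h : (α.toBlocks₁₁ * (Pᴴ * Q) * Z).trace = (Pᴴ * Q * (Z * α.toBlocks₁₁)).trace := by
    rw [Matrix.mul_assoc, Matrix.trace_mul_comm, Matrix.mul_assoc]
  simp only [formU₂, Matrix.sub_mul, Matrix.trace_sub, h]
  simp [contr, Matrix.mul_assoc]

theorem trace_mul_formV₂ (β : AmbMat m n) (P Q : Matrix (Fin n) (Fin m) ℂ)
    (V : Matrix (Fin n) (Fin n) ℂ) : (V * formV₂ β P Q).trace =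
      contr V β.toBlocks₁₁ P Q - contr (β.toBlocks₂₂ * V) 1 P Q - contr (V * β.toBlocks₂₂) 1 P Q := by
  have h1 : (V * (Q * β.toBlocks₁₁ * Pᴴ)).trace = (Pᴴ * V * Q * β.toBlocks₁₁).trace := by
    rw [← Matrix.mul_assoc, Matrix.trace_mul_comm]; simp only [Matrix.mul_assoc]
  have h2 : (V * (Q * Pᴴ * β.toBlocks₂₂)).trace = (Pᴴ * (β.toBlocks₂₂ * V) * Q).trace := by
    rw [Matrix.mul_assoc, ← Matrix.mul_assoc, Matrix.trace_mul_comm]; simp only [Matrix.mul_assoc]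
  have h3 : (V * (β.toBlocks₂₂ * (Q * Pᴴ))).trace = (Pᴴ * (V * β.toBlocks₂₂) * Q).trace := by
    rw [← Matrix.mul_assoc, ← Matrix.mul_assoc, Matrix.trace_mul_comm]
    simp only [Matrix.mul_assoc]
  simp only [formV₂, Matrix.mul_sub, Matrix.trace_sub, h1, h2, h3]
  simp [contr]

/-- The 2-jet of the field attached to `α` on `U*` and `β` on `U^⊥`. If one of the two forms has no
first-order part, then all second derivatives are of mixed type. -/
theorem prodForm_jet (α β : AmbMat m n)
    (hαβ : (α.toBlocks₁₂ = 0 ∧ α.toBlocks₂₁ = 0) ∨ (β.toBlocks₁₂ = 0 ∧ β.toBlocks₂₁ = 0))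
    (X Y : Matrix (Fin n) (Fin m) ℂ) :
    Jet2 (fun x : Idx m n → ℝ => (formU α (toW x) * Yᴴ * formV β (toW x) * X).trace)
      (α.toBlocks₁₁ * Yᴴ * β.toBlocks₂₂ * X).trace
      (fun a => (α.toBlocks₁₂ * coordMat a * (Yᴴ * β.toBlocks₂₂ * X)).trace -
          (coordMat a * β.toBlocks₁₂ * (X * α.toBlocks₁₁ * Yᴴ)).trace +
        ((coordMat a)ᴴ * (α.toBlocks₂₁ * (Yᴴ * β.toBlocks₂₂ * X))).trace -
          ((coordMat a)ᴴ * (X * α.toBlocks₁₁ * Yᴴ * β.toBlocks₂₁)).trace)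
      (fun a b => (formU₂ α (coordMat a) (coordMat b) * (Yᴴ * β.toBlocks₂₂ * X)).trace +
        (X * α.toBlocks₁₁ * Yᴴ * formV₂ β (coordMat a) (coordMat b)).trace +
        ((formU₂ α (coordMat b) (coordMat a) * (Yᴴ * β.toBlocks₂₂ * X)).trace +
        (X * α.toBlocks₁₁ * Yᴴ * formV₂ β (coordMat b) (coordMat a)).trace)) := by
  have hr : ∀ M : Matrix (Fin n) (Fin n) ℂ, (α.toBlocks₁₁ * (Yᴴ * (M * X))).trace =
      (X * (α.toBlocks₁₁ * (Yᴴ * M))).trace := by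
    intro M
    simpa only [Matrix.mul_assoc] using Matrix.trace_mul_comm (α.toBlocks₁₁ * Yᴴ * M) X
  refine ((((formU_jet α).mul (MatJet.const Yᴴ)).mul (formV_jet β)).mul
    (MatJet.const X)).trace.congr rfl ?_ ?_
  · intro a
    have h1 : (coordMat a * β.toBlocks₁₂ * (X * α.toBlocks₁₁ * Yᴴ)).trace =
        (α.toBlocks₁₁ * Yᴴ * (coordMat a * β.toBlocks₁₂) * X).trace := by
      rw [Matrix.trace_mul_comm]
      have h3 := hr (coordMat a * β.toBlocks₁₂)
      simp only [Matrix.mul_assoc] at h3 ⊢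
      exact h3.symm
    have h2 : ((coordMat a)ᴴ * (X * α.toBlocks₁₁ * Yᴴ * β.toBlocks₂₁)).trace =
        (α.toBlocks₁₁ * Yᴴ * (β.toBlocks₂₁ * (coordMat a)ᴴ) * X).trace := by
      have h3 := hr (β.toBlocks₂₁ * (coordMat a)ᴴ)
      rw [Matrix.trace_mul_comm]
      simp only [Matrix.mul_assoc] at h3 ⊢
      exact h3.symm
    rw [h1, h2]
    simp only [Matrix.mul_assoc, Matrix.add_mul, Matrix.mul_add, Matrix.mul_neg, Matrix.neg_mul,
      Matrix.mul_zero, add_zero, Matrix.trace_add, Matrix.trace_neg]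
    ring
  · intro a b
    -- the product of the two first-order parts, the only source of derivatives of pure type
    have hc : ∀ a b : Idx m n,
        (α.toBlocks₁₂ * coordMat a + (coordMat a)ᴴ * α.toBlocks₂₁) * Yᴴ *
          -(coordMat b * β.toBlocks₁₂ + β.toBlocks₂₁ * (coordMat b)ᴴ) = 0 := by
      intro a b
      rcases hαβ with ⟨h1, h2⟩ | ⟨h1, h2⟩ <;> simp [h1, h2]
    have h1 := hr (formV₂ β (coordMat a) (coordMat b))
    have h2 := hr (formV₂ β (coordMat b) (coordMat a))
    simp only [Matrix.mul_zero, add_zero, hc]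
    simp only [Matrix.mul_assoc, Matrix.add_mul, Matrix.mul_add, Matrix.trace_add] at h1 h2 ⊢
    rw [h1, h2]
    ring

theorem trace_rotate (s : Matrix (Fin m) (Fin m) ℂ) (t : Matrix (Fin n) (Fin n) ℂ)
    (X Y : Matrix (Fin n) (Fin m) ℂ) : (s * Yᴴ * t * X).trace = contr t s Y X := by
  rw [contr, Matrix.trace_mul_comm _ s]; simp only [Matrix.mul_assoc]

theorem fubiniStudy_jet (A : Frame m n) : FieldJet (fubiniStudy m n) A
    (fun X Y => contr 1 1 Y X) (fun _ _ _ => 0)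
    (fun P Q X Y => -contr 1 (Yᴴ * X) P Q - contr (X * Yᴴ) 1 P Q) := by
  intro X Y
  have h : ∀ x, fubiniStudy m n (chart A (toW x)) (velocity A (toW x) X) (velocity A (toW x) Y) = _ :=
    fun x => prodForm_chart A (toW x) 1 1 X Y
  simp only [h, inFrame_one]
  refine (prodForm_jet 1 1 (Or.inl ⟨toBlocks₁₂_one, toBlocks₂₁_one⟩) X Y).congr ?_ ?_ ?_
  · rw [trace_rotate, toBlocks₁₁_one, toBlocks₂₂_one]
  · simp [toBlocks₁₂_one, toBlocks₂₁_one]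
  · intro a b
    simp only [trace_formU₂_mul, trace_mul_formV₂, toBlocks₁₁_one, toBlocks₂₂_one, Matrix.mul_one,
      Matrix.one_mul]
    ring

theorem h₁_jet (A : Frame m n) (γ : AmbMat m n) : FieldJet (h₁ γ) A
    (fun X Y => contr (inFrame A γ).toBlocks₂₂ 1 Y X)
    (fun P X Y => -(P * (inFrame A γ).toBlocks₁₂ * (X * Yᴴ)).trace -
      (Pᴴ * (X * Yᴴ * (inFrame A γ).toBlocks₂₁)).trace)
    (fun P Q X Y => contr (X * Yᴴ) (inFrame A γ).toBlocks₁₁ P Q -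
      contr 1 (Yᴴ * (inFrame A γ).toBlocks₂₂ * X) P Q -
      contr ((inFrame A γ).toBlocks₂₂ * (X * Yᴴ)) 1 P Q -
      contr (X * Yᴴ * (inFrame A γ).toBlocks₂₂) 1 P Q) := by
  intro X Y
  have h : ∀ x, h₁ γ (chart A (toW x)) (velocity A (toW x) X) (velocity A (toW x) Y) = _ :=
    fun x => prodForm_chart A (toW x) 1 γ X Y
  simp only [h, inFrame_one]
  refine (prodForm_jet 1 (inFrame A γ) (Or.inl ⟨toBlocks₁₂_one, toBlocks₂₁_one⟩) X Y).congr ?_ ?_ ?_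
  · rw [trace_rotate, toBlocks₁₁_one]
  · simp [toBlocks₁₂_one, toBlocks₂₁_one, toBlocks₁₁_one]
  · intro a b
    simp only [trace_formU₂_mul, trace_mul_formV₂, toBlocks₁₁_one, toBlocks₂₂_one, Matrix.mul_one,
      Matrix.one_mul]
    ring

theorem h₂_jet (A : Frame m n) (γ : AmbMat m n) : FieldJet (h₂ γ) A
    (fun X Y => contr 1 (inFrame A γ).toBlocks₁₁ Y X)
    (fun P X Y => ((inFrame A γ).toBlocks₁₂ * P * (Yᴴ * X)).trace +
      (Pᴴ * ((inFrame A γ).toBlocks₂₁ * (Yᴴ * X))).trace)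
    (fun P Q X Y => contr (inFrame A γ).toBlocks₂₂ (Yᴴ * X) P Q -
      contr 1 ((inFrame A γ).toBlocks₁₁ * (Yᴴ * X)) P Q -
      contr 1 (Yᴴ * X * (inFrame A γ).toBlocks₁₁) P Q -
      contr (X * (inFrame A γ).toBlocks₁₁ * Yᴴ) 1 P Q) := by
  intro X Y
  have h : ∀ x, h₂ γ (chart A (toW x)) (velocity A (toW x) X) (velocity A (toW x) Y) = _ :=
    fun x => prodForm_chart A (toW x) γ 1 X Y
  simp only [h, inFrame_one]
  refine (prodForm_jet (inFrame A γ) 1 (Or.inr ⟨toBlocks₁₂_one, toBlocks₂₁_one⟩) X Y).congr ?_ ?_ ?_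
  · rw [trace_rotate, toBlocks₂₂_one]
  · simp [toBlocks₁₂_one, toBlocks₂₁_one, toBlocks₂₂_one]
  · intro a b
    simp only [trace_formU₂_mul, trace_mul_formV₂, toBlocks₁₁_one, toBlocks₂₂_one, Matrix.mul_one,
      Matrix.one_mul]
    ring

theorem h₃_jet (A : Frame m n) (γ : AmbMat m n) : FieldJet (h₃ γ) A
    (fun X Y => (inFrame A γ).toBlocks₁₁.trace * contr 1 1 Y X)
    (fun P X Y => (((inFrame A γ).toBlocks₁₂ * P).trace +
      (Pᴴ * (inFrame A γ).toBlocks₂₁).trace) * contr 1 1 Y X)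
    (fun P Q X Y => (contr (inFrame A γ).toBlocks₂₂ 1 P Q - contr 1 (inFrame A γ).toBlocks₁₁ P Q) *
        contr 1 1 Y X -
      (inFrame A γ).toBlocks₁₁.trace * (contr 1 (Yᴴ * X) P Q + contr (X * Yᴴ) 1 P Q)) := by
  intro X Y
  have h : ∀ x, h₃ γ (chart A (toW x)) (velocity A (toW x) X) (velocity A (toW x) Y) =
      fγ γ (chart A (toW x)) *
        fubiniStudy m n (chart A (toW x)) (velocity A (toW x) X) (velocity A (toW x) Y) :=
    fun x => rfl
  simp only [h, fγ_chart]
  refine ((traceU_jet (inFrame A γ)).mul (fubiniStudy_jet A X Y)).congr rfl ?_ ?_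
  · intro a; simp [Matrix.trace_add]
  · intro a b
    simp only [contr, Matrix.trace_sub, Matrix.mul_one]
    ring

theorem FieldJet.add {h h' : SesqField m n} {A : Frame m n} {h0 h0' l l' Φ Φ'}
    (H : FieldJet h A h0 l Φ) (H' : FieldJet h' A h0' l' Φ') :
    FieldJet (fun U => h U + h' U) A (fun X Y => h0 X Y + h0' X Y)
      (fun P X Y => l P X Y + l' P X Y) (fun P Q X Y => Φ P Q X Y + Φ' P Q X Y) := fun X Y =>
  ((H X Y).add (H' X Y)).congr rfl (fun _ => rfl) fun _ _ => by ring

theorem FieldJet.smul {h : SesqField m n} {A : Frame m n} {h0 l Φ} (c : ℂ)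
    (H : FieldJet h A h0 l Φ) :
    FieldJet (fun U => c • h U) A (fun X Y => c * h0 X Y)
      (fun P X Y => c * l P X Y) (fun P Q X Y => c * Φ P Q X Y) := fun X Y =>
  ((H X Y).const_mul c).congr rfl (fun _ => rfl) fun _ _ => by ring

end FieldJets

/-! ### Contractions over coordinate vectors -/

section Sums

theorem trace_unitMat_conj_mul (I : Fin n × Fin m) (T : Matrix (Fin n) (Fin m) ℂ) :
    ((unitMat I)ᴴ * T).trace = T I.1 I.2 := by
  simp [unitMat, Matrix.trace_single_mul]

theorem trace_mul_unitMat (I : Fin n × Fin m) (S : Matrix (Fin m) (Fin n) ℂ) :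
    (S * unitMat I).trace = S I.2 I.1 := by
  simp [unitMat, Matrix.trace_mul_single]

theorem contr_unitMat (t : Matrix (Fin n) (Fin n) ℂ) (s : Matrix (Fin m) (Fin m) ℂ)
    (I J : Fin n × Fin m) : contr t s (unitMat I) (unitMat J) = t I.1 J.1 * s J.2 I.2 := by
  have h : contr t s (unitMat I) (unitMat J) = ((unitMat I)ᴴ * (t * unitMat J * s)).trace := by
    simp only [contr, Matrix.mul_assoc]
  rw [h, trace_unitMat_conj_mul]
  simp [unitMat, Matrix.mul_apply, Matrix.single_apply, ite_and]

theorem sum_contr (t : Matrix (Fin n) (Fin n) ℂ) (s : Matrix (Fin m) (Fin m) ℂ) :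
    ∑ I : Fin n × Fin m, contr t s (unitMat I) (unitMat I) = t.trace * s.trace := by
  simp only [contr_unitMat, Fintype.sum_prod_type, Matrix.trace, Matrix.diag_apply,
    Finset.sum_mul_sum]

theorem sum_trace_mul_trace (S : Matrix (Fin m) (Fin n) ℂ) (T : Matrix (Fin n) (Fin m) ℂ) :
    ∑ I : Fin n × Fin m, ((unitMat I)ᴴ * T).trace * (S * unitMat I).trace = (S * T).trace := by
  simp only [trace_unitMat_conj_mul, trace_mul_unitMat, Fintype.sum_prod_type]
  simp only [Matrix.trace, Matrix.diag_apply, Matrix.mul_apply]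
  rw [Finset.sum_comm]
  simp only [mul_comm]

theorem sum_idx {F : Type*} [AddCommMonoid F] (f : Idx m n → F) :
    ∑ a, f a = ∑ I, (f (I, 0) + f (I, 1)) := by
  rw [Fintype.sum_prod_type]; simp only [Fin.sum_univ_two]

/-- `Ψ` is homogeneous: conjugate linear in the first and linear in the second argument. -/
def IsSesq (Ψ : Matrix (Fin n) (Fin m) ℂ → Matrix (Fin n) (Fin m) ℂ → ℂ) : Prop :=
  ∀ (c d : ℂ) (P Q : Matrix (Fin n) (Fin m) ℂ), Ψ (c • P) (d • Q) = conj c * d * Ψ P Q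

theorem isSesq_contr (t : Matrix (Fin n) (Fin n) ℂ) (s : Matrix (Fin m) (Fin m) ℂ) :
    IsSesq (contr t s) := by
  intro c d P Q
  simp [contr, Matrix.trace_smul, mul_assoc]
  ring

variable {Ψ : Matrix (Fin n) (Fin m) ℂ → Matrix (Fin n) (Fin m) ℂ → ℂ}

theorem IsSesq.sum_idx (h : IsSesq Ψ) :
    ∑ a : Idx m n, Ψ (coordMat a) (coordMat a) = 2 * ∑ I, Ψ (unitMat I) (unitMat I) := by
  rw [GrassmannEID.sum_idx, Finset.mul_sum]
  refine Finset.sum_congr rfl fun I _ => ?_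
  rw [coordMat_zero, coordMat_one, h]
  simp; ring

/-- A sum over the real coordinate vectors vanishes if its terms are bilinear, or conjugate linear
in both arguments. -/
theorem sum_idx_eq_zero (h : ∀ P, Ψ (Complex.I • P) (Complex.I • P) = -Ψ P P) :
    ∑ a : Idx m n, Ψ (coordMat a) (coordMat a) = 0 := by
  rw [sum_idx]
  refine Finset.sum_eq_zero fun I _ => ?_
  rw [coordMat_zero, coordMat_one, h]
  simp

/-- Expansion of `T` in the real coordinate vectors, inside a linear functional. -/
theorem sum_re_mul_re (L : Matrix (Fin m) (Fin n) ℂ) (T : Matrix (Fin n) (Fin m) ℂ) :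
    ∑ a : Idx m n, ((coordMat a)ᴴ * T).trace.re * (L * coordMat a).trace.re =
      (L * T).trace.re := by
  rw [← sum_trace_mul_trace, sum_idx, Complex.re_sum]
  refine Finset.sum_congr rfl fun I _ => ?_
  rw [coordMat_zero, coordMat_one]
  simp [Matrix.trace_smul, sub_eq_add_neg]

end Sums

/-! ### Derivatives of components in terms of jets -/

section Derivatives

/-- A derivative `p + r` in real directions, with `p` complex linear and `r` conjugate linear, has
the `∂/∂w_I`-component `p`. -/
theorem dw_of_jet {u : (Idx m n → ℝ) → ℂ} {c : ℂ} {l : Idx m n → ℂ} {q : Idx m n → Idx m n → ℂ}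
    (hu : Jet2 u c l q) {p r : Matrix (Fin n) (Fin m) ℂ → ℂ}
    (hl : ∀ a, l a = p (coordMat a) + r (coordMat a))
    (hp : ∀ P, p (Complex.I • P) = Complex.I * p P)
    (hr : ∀ P, r (Complex.I • P) = -Complex.I * r P) (I : Fin n × Fin m) :
    dw I u 0 = p (unitMat I) := by
  rw [dw, hu.fst, hu.fst, hl, hl, coordMat_zero, coordMat_one, hp, hr]
  linear_combination (-(p (unitMat I)) + r (unitMat I)) / 2 * Complex.I_mul_I

/-- The mixed derivatives `∂_A ∂_B̄` when the real Hessian is the symmetrization of a form that is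
linear in one direction and conjugate linear in the other. -/
theorem dw_dwbar_of_jet {u : (Idx m n → ℝ) → ℂ} {c : ℂ} {l : Idx m n → ℂ}
    {q : Idx m n → Idx m n → ℂ} (hu : Jet2 u c l q)
    {Ψ : Matrix (Fin n) (Fin m) ℂ → Matrix (Fin n) (Fin m) ℂ → ℂ} (hΨ : IsSesq Ψ)
    (hq : ∀ a b, q a b = Ψ (coordMat a) (coordMat b) + Ψ (coordMat b) (coordMat a))
    (A B : Fin n × Fin m) : dw A (dwbar B u) 0 = Ψ (unitMat B) (unitMat A) := by
  have d := fun a => smooth_diffAt (pd_contDiff hu.smooth a) 0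
  have h : ∀ c, pd c (dwbar B u) 0 = (q c (B, 0) + Complex.I * q c (B, 1)) / 2 := by
    intro c
    have : dwbar B u = fun y => (1 / 2 : ℂ) * (pd (B, 0) u y + Complex.I * pd (B, 1) u y) := by
      funext y; simp only [dwbar]; ring
    rw [this, pd_const_mul _ ((d _).fun_add ((d _).const_mul _)), pd_add (d _) ((d _).const_mul _),
      pd_const_mul _ (d _), hu.snd, hu.snd]
    ring
  have h1 : ∀ (c : ℂ) P Q, Ψ (c • P) Q = conj c * Ψ P Q := fun c P Q => by
    simpa using hΨ c 1 P Q
  have h2 : ∀ (c : ℂ) P Q, Ψ P (c • Q) = c * Ψ P Q := fun c P Q => by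
    simpa using hΨ 1 c P Q
  rw [dw, h, h]
  simp only [hq, coordMat_zero, coordMat_one, h1, h2, Complex.conj_I]
  ring_nf
  simp only [Complex.I_sq, Complex.I_pow_four]
  ring

variable {h : SesqField m n} {A : Frame m n}
  {h0 : Matrix (Fin n) (Fin m) ℂ → Matrix (Fin n) (Fin m) ℂ → ℂ}
  {l : Matrix (Fin n) (Fin m) ℂ → Matrix (Fin n) (Fin m) ℂ → Matrix (Fin n) (Fin m) ℂ → ℂ}
  {Φ : Matrix (Fin n) (Fin m) ℂ → Matrix (Fin n) (Fin m) ℂ → Matrix (Fin n) (Fin m) ℂ →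
    Matrix (Fin n) (Fin m) ℂ → ℂ}

/-- The jet of the real tensor `2 Re h`, in real coordinates. -/
theorem FieldJet.real_jet (H : FieldJet h A h0 l Φ) (a b : Idx m n) :
    Jet2 (fun x => h.real.inChart A x a b) (2 * (h0 (coordMat a) (coordMat b)).re)
      (fun c => 2 * (l (coordMat c) (coordMat a) (coordMat b)).re)
      (fun e c => 2 * (Φ (coordMat e) (coordMat c) (coordMat a) (coordMat b) +
        Φ (coordMat c) (coordMat e) (coordMat a) (coordMat b)).re) :=
  (H (coordMat a) (coordMat b)).clm ((2 : ℝ) • Complex.reCLM)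

theorem FieldJet.inChart_jet (H : FieldJet h A h0 l Φ) (I J : Fin n × Fin m) :
    Jet2 (fun x => h.inChart A x I J) (h0 (unitMat I) (unitMat J))
      (fun c => l (coordMat c) (unitMat I) (unitMat J))
      (fun e c => Φ (coordMat e) (coordMat c) (unitMat I) (unitMat J) +
        Φ (coordMat c) (coordMat e) (unitMat I) (unitMat J)) :=
  H (unitMat I) (unitMat J)

theorem FieldJet.form_jet (H : FieldJet h A h0 l Φ) (I J : Fin n × Fin m) :
    Jet2 (h.form A I J) (Complex.I * h0 (unitMat I) (unitMat J))
      (fun c => Complex.I * l (coordMat c) (unitMat I) (unitMat J))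
      (fun e c => Complex.I * (Φ (coordMat e) (coordMat c) (unitMat I) (unitMat J) +
        Φ (coordMat c) (coordMat e) (unitMat I) (unitMat J))) :=
  (H.inChart_jet I J).const_mul Complex.I

end Derivatives

/-! ### Curvature of the Fubini-Study metric -/

section Metric

variable (A : Frame m n)

theorem contr_one_unitMat (I J : Fin n × Fin m) :
    contr 1 1 (unitMat J) (unitMat I) = if I = J then 1 else 0 := by
  rw [contr_unitMat]
  simp only [Matrix.one_apply, Prod.ext_iff, mul_ite, mul_one, mul_zero, ← ite_and]
  congr 1
  simp only [eq_comm, and_comm]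

theorem re_contr_one_coordMat (a b : Idx m n) :
    (contr 1 1 (coordMat b) (coordMat a)).re = if a = b then 1 else 0 := by
  obtain ⟨I, s⟩ := a
  obtain ⟨J, r⟩ := b
  have h := isSesq_contr (1 : Matrix (Fin n) (Fin n) ℂ) (1 : Matrix (Fin m) (Fin m) ℂ)
  have h1 : ∀ (c : ℂ) P Q, contr (1 : Matrix (Fin n) (Fin n) ℂ) (1 : Matrix (Fin m) (Fin m) ℂ)
      (c • P) Q = conj c * contr 1 1 P Q := fun c P Q => by simpa using h c 1 P Q
  have h2 : ∀ (c : ℂ) P Q, contr (1 : Matrix (Fin n) (Fin n) ℂ) (1 : Matrix (Fin m) (Fin m) ℂ)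
      P (c • Q) = c * contr 1 1 P Q := fun c P Q => by simpa using h 1 c P Q
  by_cases hIJ : I = J <;> fin_cases s <;> fin_cases r <;>
    simp [coordMat_zero, coordMat_one, h1, h2, contr_one_unitMat, hIJ]

theorem fubiniStudy_normalAt : NormalAt 2 ((fubiniStudy m n).real.inChart A) where
  pos := two_pos
  smooth a b := ((fubiniStudy_jet A).real_jet a b).smooth
  val := by
    ext a b
    rw [((fubiniStudy_jet A).real_jet a b).val, re_contr_one_coordMat]
    simp [Matrix.one_apply]
  fst a b c := by
    rw [((fubiniStudy_jet A).real_jet b c).fst]; simp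

theorem fubiniStudy_kNormalAt : KNormalAt ((fubiniStudy m n).inChart A) where
  smooth I J := ((fubiniStudy_jet A).inChart_jet I J).smooth
  val := by
    ext I J
    rw [((fubiniStudy_jet A).inChart_jet I J).val, contr_one_unitMat, Matrix.one_apply]
  fst a I J := ((fubiniStudy_jet A).inChart_jet I J).fst a

/-- `Re tr(P* Q R* S)`. -/
def reTrace4 (P Q R S : Matrix (Fin n) (Fin m) ℂ) : ℝ := (Pᴴ * Q * Rᴴ * S).trace.re

theorem reTrace4_swap (P Q R S : Matrix (Fin n) (Fin m) ℂ) :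
    reTrace4 P Q R S = reTrace4 R S P Q := by
  rw [reTrace4, reTrace4, Matrix.mul_assoc, Matrix.trace_mul_comm]
  simp only [Matrix.mul_assoc]

theorem reTrace4_reverse (P Q R S : Matrix (Fin n) (Fin m) ℂ) :
    reTrace4 P Q R S = reTrace4 S R Q P := by
  have h : (Pᴴ * Q * Rᴴ * S)ᴴ = Sᴴ * R * Qᴴ * P := by
    simp only [Matrix.conjTranspose_mul, Matrix.conjTranspose_conjTranspose, Matrix.mul_assoc]
  rw [reTrace4, reTrace4, ← h, Matrix.trace_conjTranspose]
  simp

/-- The curvature of the Fubini-Study metric at the centre of a chart: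
`R(A, B) C = A B* C + C B* A - B A* C - C A* B`. -/
def curvMat (A B C : Matrix (Fin n) (Fin m) ℂ) : Matrix (Fin n) (Fin m) ℂ :=
  A * Bᴴ * C + C * Bᴴ * A - B * Aᴴ * C - C * Aᴴ * B

theorem re_trace_curvMat (A B C D : Matrix (Fin n) (Fin m) ℂ) :
    (Dᴴ * curvMat A B C).trace.re =
      reTrace4 D A B C + reTrace4 D C B A - reTrace4 D B A C - reTrace4 D C A B := by
  simp [curvMat, reTrace4, Matrix.mul_add, Matrix.mul_sub, Matrix.mul_assoc]

theorem pd2_fubiniStudy (a b e c : Idx m n) :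
    pd2 ((fubiniStudy m n).real.inChart A) a b e c =
      -2 * (reTrace4 (coordMat e) (coordMat c) (coordMat b) (coordMat a) +
        reTrace4 (coordMat e) (coordMat a) (coordMat b) (coordMat c) +
        reTrace4 (coordMat c) (coordMat e) (coordMat b) (coordMat a) +
        reTrace4 (coordMat c) (coordMat a) (coordMat b) (coordMat e)) := by
  rw [pd2, ((fubiniStudy_jet A).real_jet a b).snd]
  simp only [contr, reTrace4, Matrix.mul_one, Matrix.mul_assoc, Complex.add_re, Complex.sub_re,
    Complex.neg_re]
  ring

theorem riemann_fubiniStudy (d c a b : Idx m n) :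
    riemann ((fubiniStudy m n).real.inChart A) d c a b 0 =
      ((coordMat d)ᴴ * curvMat (coordMat a) (coordMat b) (coordMat c)).trace.re := by
  have hg := fubiniStudy_normalAt (m := m) (n := n) A
  rw [hg.riemann_eq, hg.pd_christoffel, hg.pd_christoffel, re_trace_curvMat]
  simp only [pd2_fubiniStudy]
  generalize coordMat a = A'
  generalize coordMat b = B
  generalize coordMat c = C
  generalize coordMat d = D
  -- the symmetries of `reTrace4` bring `A'` to the first place in every term
  have e1 : ∀ X Y Z, reTrace4 X A' Y Z = reTrace4 A' X Z Y := fun X Y Z => by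
    rw [reTrace4_reverse, reTrace4_swap]
  have e2 : ∀ X Y Z, reTrace4 X Y A' Z = reTrace4 A' Z X Y := fun X Y Z => reTrace4_swap ..
  have e3 : ∀ X Y Z, reTrace4 X Y Z A' = reTrace4 A' Z Y X := fun X Y Z => reTrace4_reverse ..
  simp only [e1, e2, e3]
  ring

theorem sum_pd_christoffel (d b : Idx m n) :
    ∑ a, pd a (christoffel ((fubiniStudy m n).real.inChart A) d a b) 0 =
      if b = d then -2 * ((n : ℝ) + m) else 0 := by
  have hg := fubiniStudy_normalAt (m := m) (n := n) A
  have h1 : ∀ a, pd a (christoffel ((fubiniStudy m n).real.inChart A) d a b) 0 =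
      (-contr 1 ((coordMat d)ᴴ * coordMat b) (coordMat a) (coordMat a) -
        contr (coordMat b * (coordMat d)ᴴ) 1 (coordMat a) (coordMat a)).re := by
    intro a
    rw [hg.pd_christoffel]
    simp only [pd2_fubiniStudy]
    have h2 : (-contr 1 ((coordMat d)ᴴ * coordMat b) (coordMat a) (coordMat a) -
        contr (coordMat b * (coordMat d)ᴴ) 1 (coordMat a) (coordMat a)).re =
        -reTrace4 (coordMat a) (coordMat a) (coordMat d) (coordMat b) -
        reTrace4 (coordMat a) (coordMat b) (coordMat d) (coordMat a) := by
      simp only [contr, reTrace4, Matrix.mul_one, Matrix.mul_assoc, Complex.sub_re,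
        Complex.neg_re]
    rw [h2]
    generalize coordMat a = A'
    generalize coordMat b = B
    generalize coordMat d = D
    have e1 := reTrace4_reverse A' B D A'
    have e2 := reTrace4_swap A' A' B D
    have e3 := reTrace4_swap A' A' D B
    have e4 := reTrace4_reverse A' A' D B
    have e5 := reTrace4_reverse A' A' B D
    have e6 := reTrace4_swap D A' B A'
    have e7 := reTrace4_reverse D A' B A'
    have e8 := reTrace4_swap A' D B A'
    have e9 := reTrace4_swap A' B D A'
    have e10 := reTrace4_reverse A' D A' B
    linarith
  simp only [h1, ← Complex.re_sum, Finset.sum_sub_distrib, Finset.sum_neg_distrib,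
    (isSesq_contr _ _).sum_idx, sum_contr]
  have h3 : (coordMat b * (coordMat d)ᴴ).trace = contr 1 1 (coordMat d) (coordMat b) := by
    rw [Matrix.trace_mul_comm]; simp [contr]
  have h4 : ((coordMat d)ᴴ * coordMat b).trace = contr 1 1 (coordMat d) (coordMat b) := by
    simp [contr]
  have h5 := re_contr_one_coordMat b d
  rw [h3, h4, Matrix.trace_one, Matrix.trace_one, Fintype.card_fin, Fintype.card_fin]
  have h6 : -(2 * ((n : ℂ) * contr 1 1 (coordMat d) (coordMat b))) -
      2 * (contr 1 1 (coordMat d) (coordMat b) * (m : ℂ)) =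
      ((-2 * ((n : ℝ) + m) : ℝ) : ℂ) * contr 1 1 (coordMat d) (coordMat b) := by
    push_cast; ring
  rw [h6, Complex.re_ofReal_mul, h5]
  simp

theorem ricci_fubiniStudy (b c : Idx m n) :
    ricci ((fubiniStudy m n).real.inChart A) b c 0 =
      ((n : ℝ) + m) * (fubiniStudy m n).real.inChart A 0 b c := by
  rw [ricci, ((fubiniStudy_jet A).real_jet b c).val]
  simp only [riemann_fubiniStudy]
  generalize coordMat b = B
  generalize coordMat c = C
  have h1 : ∀ P : Matrix (Fin n) (Fin m) ℂ, (Pᴴ * curvMat P B C).trace =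
      contr 1 (Bᴴ * C) P P + contr (C * Bᴴ) 1 P P -
        (Pᴴ * B * Pᴴ * C + Pᴴ * C * Pᴴ * B).trace := by
    intro P
    simp only [curvMat, contr, Matrix.mul_add, Matrix.mul_sub, Matrix.trace_add, Matrix.trace_sub,
      Matrix.mul_assoc, Matrix.mul_one]
    ring
  have h2 := sum_idx_eq_zero (m := m) (n := n)
    (Ψ := fun P _ => (Pᴴ * B * Pᴴ * C + Pᴴ * C * Pᴴ * B).trace) fun P => by
      simp only [Matrix.conjTranspose_smul, Matrix.smul_mul, Matrix.mul_smul, smul_smul,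
        ← smul_add, Matrix.trace_smul]
      simp
  have h3 : (C * Bᴴ).trace = (Bᴴ * C).trace := Matrix.trace_mul_comm _ _
  have h4 : (contr 1 1 C B).re = (Bᴴ * C).trace.re := by
    have := Matrix.trace_conjTranspose (Bᴴ * C)
    rw [Matrix.conjTranspose_mul, Matrix.conjTranspose_conjTranspose] at this
    simp [contr, this]
  rw [← Complex.re_sum]
  simp only [h1, Finset.sum_sub_distrib, Finset.sum_add_distrib, h2, (isSesq_contr _ _).sum_idx,
    sum_contr, h3, Matrix.trace_one, Fintype.card_fin, h4]
  have h6 : 2 * ((n : ℂ) * (Bᴴ * C).trace) + 2 * ((Bᴴ * C).trace * (m : ℂ)) - 0 =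
      ((((n : ℝ) + m) * 2 : ℝ) : ℂ) * (Bᴴ * C).trace := by
    push_cast; ring
  rw [h6, Complex.re_ofReal_mul, mul_assoc]

end Metric

/-! ### The Laplacians and the curvature operator on a field with known jet -/

section Operators

variable {h : SesqField m n} {A : Frame m n}
  {h0 : Matrix (Fin n) (Fin m) ℂ → Matrix (Fin n) (Fin m) ℂ → ℂ}
  {l : Matrix (Fin n) (Fin m) ℂ → Matrix (Fin n) (Fin m) ℂ → Matrix (Fin n) (Fin m) ℂ → ℂ}
  {Φ : Matrix (Fin n) (Fin m) ℂ → Matrix (Fin n) (Fin m) ℂ → Matrix (Fin n) (Fin m) ℂ →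
    Matrix (Fin n) (Fin m) ℂ → ℂ}

theorem FieldJet.connLaplacian_eq (H : FieldJet h A h0 l Φ)
    (hΦ : ∀ X Y, IsSesq fun P Q => Φ P Q X Y) (b c : Idx m n) :
    connLaplacian ((fubiniStudy m n).real.inChart A) (h.real.inChart A) b c 0 =
      4 * (∑ I, Φ (unitMat I) (unitMat I) (coordMat b) (coordMat c)).re +
        4 * ((n : ℝ) + m) * (h0 (coordMat b) (coordMat c)).re := by
  have hg := fubiniStudy_normalAt (m := m) (n := n) A
  rw [hg.connLaplacian_eq fun a b => (H.real_jet a b).smooth]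
  have h1 : ∑ a, pd2 (h.real.inChart A) b c a a =
      8 * (∑ I, Φ (unitMat I) (unitMat I) (coordMat b) (coordMat c)).re := by
    have h2 : ∀ a, pd2 (h.real.inChart A) b c a a =
        4 * (Φ (coordMat a) (coordMat a) (coordMat b) (coordMat c)).re := by
      intro a
      rw [pd2, (H.real_jet b c).snd, Complex.add_re]; ring
    simp only [h2, ← Finset.mul_sum, ← Complex.re_sum]
    rw [(hΦ (coordMat b) (coordMat c)).sum_idx]
    simp; ring
  simp only [h1, sum_pd_christoffel, ite_mul, zero_mul, Finset.sum_add_distrib,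
    Finset.sum_ite_eq, Finset.mem_univ, if_true, (H.real_jet b c).val]
  ring

/-- The curvature operator of the Fubini-Study metric on the form of `h`; the terms of the curvature
that are conjugate linear in the contracted vector drop out. -/
theorem FieldJet.curvOp_eq (H : FieldJet h A h0 l Φ)
    (hL : ∀ Y, ∃ L : Matrix (Fin m) (Fin n) ℂ, ∀ X, h0 X Y = (L * X).trace)
    (hs : IsSesq fun Y X => h0 X Y) (b c : Idx m n) :
    curvOp ((fubiniStudy m n).real.inChart A) (h.real.inChart A) b c 0 =
      2 * (∑ I, h0 (unitMat I * (coordMat b)ᴴ * coordMat c + coordMat c * (coordMat b)ᴴ * unitMat I)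
        (unitMat I)).re := by
  have hg := fubiniStudy_normalAt (m := m) (n := n) A
  rw [hg.curvOp_eq]
  have h1 : ∀ a, ∑ d, riemann ((fubiniStudy m n).real.inChart A) d c a b 0 *
      h.real.inChart A 0 d a =
      2 * (h0 (curvMat (coordMat a) (coordMat b) (coordMat c)) (coordMat a)).re := by
    intro a
    obtain ⟨L, hL⟩ := hL (coordMat a)
    rw [hL, ← sum_re_mul_re, Finset.mul_sum]
    refine Finset.sum_congr rfl fun d _ => ?_
    rw [riemann_fubiniStudy, (H.real_jet d a).val, hL]
    ring
  have hadd : ∀ X X' Y, h0 (X + X') Y = h0 X Y + h0 X' Y := by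
    intro X X' Y
    obtain ⟨L, hL⟩ := hL Y
    simp [hL, Matrix.mul_add]
  have hsub : ∀ X X' Y, h0 (X - X') Y = h0 X Y - h0 X' Y := by
    intro X X' Y
    obtain ⟨L, hL⟩ := hL Y
    simp [hL, Matrix.mul_sub]
  generalize coordMat b = B at *
  generalize coordMat c = C at *
  have h2 : IsSesq fun P Q : Matrix (Fin n) (Fin m) ℂ => h0 (Q * Bᴴ * C + C * Bᴴ * Q) P := by
    intro x y P Q
    have := hs x y P (Q * Bᴴ * C + C * Bᴴ * Q)
    simpa using this
  have h3 := sum_idx_eq_zero (m := m) (n := n)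
    (Ψ := fun P _ => h0 (B * Pᴴ * C + C * Pᴴ * B) P) fun P => by
      have := hs Complex.I (-Complex.I) P (B * Pᴴ * C + C * Pᴴ * B)
      simpa using this
  have h4 : ∀ P, h0 (curvMat P B C) P =
      h0 (P * Bᴴ * C + C * Bᴴ * P) P - h0 (B * Pᴴ * C + C * Pᴴ * B) P := by
    intro P
    rw [← hsub, curvMat, sub_sub]
  simp only [h1, ← Finset.mul_sum, ← Complex.re_sum]
  simp only [h4, Finset.sum_sub_distrib]
  rw [h3, h2.sum_idx]
  simp

/-- The curvature term comes from the second derivatives of the metric, which are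
`-tr(P* (E J* I + I J* E))` in the directions `E`, `J`. -/
theorem FieldJet.dbarLaplacian_eq (H : FieldJet h A h0 l Φ)
    (hΦ : ∀ X Y, IsSesq fun P Q => Φ P Q X Y)
    (hL : ∀ Y, ∃ L : Matrix (Fin m) (Fin n) ℂ, ∀ X, h0 X Y = (L * X).trace)
    (I J : Fin n × Fin m) :
    dbarLaplacian ((fubiniStudy m n).inChart A) (h.form A) I J 0 = -Complex.I *
      (∑ E, h0 (unitMat E * (unitMat J)ᴴ * unitMat I + unitMat I * (unitMat J)ᴴ * unitMat E)
        (unitMat E) + ∑ E, Φ (unitMat E) (unitMat E) (unitMat I) (unitMat J)) := by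
  have hg := fubiniStudy_kNormalAt (m := m) (n := n) A
  rw [hg.dbarLaplacian_eq fun I J => (H.form_jet I J).smooth]
  have h1 : ∀ E, dw E (dwbar E (h.form A I J)) 0 =
      Complex.I * Φ (unitMat E) (unitMat E) (unitMat I) (unitMat J) := fun E =>
    dw_dwbar_of_jet (Ψ := fun P Q => Complex.I * Φ P Q (unitMat I) (unitMat J)) (H.form_jet I J)
      (fun c d P Q => by have := hΦ (unitMat I) (unitMat J) c d P Q; simp only [this]; ring)
      (fun a b => by ring) E E
  have h2 : ∀ E P, dw E (dwbar J fun y => (fubiniStudy m n).inChart A y I P) 0 =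
      -((unitMat P)ᴴ * (unitMat E * (unitMat J)ᴴ * unitMat I +
        unitMat I * (unitMat J)ᴴ * unitMat E)).trace := by
    intro E P
    rw [dw_dwbar_of_jet (Ψ := fun P' Q => -contr 1 ((unitMat P)ᴴ * unitMat I) P' Q -
      contr (unitMat I * (unitMat P)ᴴ) 1 P' Q) ((fubiniStudy_jet A).inChart_jet I P)
      (fun c d P' Q => by
        have e := fun t s => isSesq_contr t s c d P' Q
        simp only [e]; ring) (fun a b => rfl) E J]
    have h3 : contr 1 ((unitMat P)ᴴ * unitMat I) (unitMat J) (unitMat E) =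
        ((unitMat P)ᴴ * (unitMat I * (unitMat J)ᴴ * unitMat E)).trace := by
      simpa only [contr, Matrix.mul_one, Matrix.mul_assoc] using
        Matrix.trace_mul_comm ((unitMat J)ᴴ * unitMat E) ((unitMat P)ᴴ * unitMat I)
    have h4 : contr (unitMat I * (unitMat P)ᴴ) 1 (unitMat J) (unitMat E) =
        ((unitMat P)ᴴ * (unitMat E * (unitMat J)ᴴ * unitMat I)).trace := by
      simpa only [contr, Matrix.mul_one, Matrix.mul_assoc] using
        Matrix.trace_mul_comm ((unitMat J)ᴴ * unitMat I) ((unitMat P)ᴴ * unitMat E)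
    rw [h3, h4, Matrix.mul_add, Matrix.trace_add]
    ring
  have h5 : ∀ E, ∑ P, dw E (dwbar J fun y => (fubiniStudy m n).inChart A y I P) 0 *
      h.form A P E 0 = -Complex.I * h0 (unitMat E * (unitMat J)ᴴ * unitMat I +
        unitMat I * (unitMat J)ᴴ * unitMat E) (unitMat E) := by
    intro E
    obtain ⟨L, hL⟩ := hL (unitMat E)
    rw [hL, ← sum_trace_mul_trace, Finset.mul_sum]
    refine Finset.sum_congr rfl fun P _ => ?_
    rw [h2, (H.form_jet P E).val, hL]
    ring
  simp only [h5, h1, ← Finset.mul_sum]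
  ring

end Operators

/-! ### The combinations of the three tensors -/

section Deformation

/-- The value at the centre of a chart of the deformation attached to the blocks `a`, `d` of `γ`,
with coefficients `k₁`, `k₂`, `k₃`. -/
def devValue (k₁ k₂ k₃ : ℂ) (γ : AmbMat m n) (X Y : Matrix (Fin n) (Fin m) ℂ) : ℂ :=
  k₁ * contr γ.toBlocks₂₂ 1 Y X + k₂ * contr 1 γ.toBlocks₁₁ Y X +
    k₃ * (γ.toBlocks₁₁.trace * contr 1 1 Y X)

/-- The complex linear part of its first derivative in the direction `P`. -/
def devLin (k₁ k₂ k₃ : ℂ) (γ : AmbMat m n) (P X Y : Matrix (Fin n) (Fin m) ℂ) : ℂ :=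
  -(k₁ * (P * γ.toBlocks₁₂ * (X * Yᴴ)).trace) + k₂ * (γ.toBlocks₁₂ * P * (Yᴴ * X)).trace +
    k₃ * ((γ.toBlocks₁₂ * P).trace * contr 1 1 Y X)

/-- The conjugate linear part of its first derivative in the direction `P`. -/
def devConj (k₁ k₂ k₃ : ℂ) (γ : AmbMat m n) (P X Y : Matrix (Fin n) (Fin m) ℂ) : ℂ :=
  -(k₁ * (Pᴴ * (X * Yᴴ * γ.toBlocks₂₁)).trace) + k₂ * (Pᴴ * (γ.toBlocks₂₁ * (Yᴴ * X))).trace +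
    k₃ * ((Pᴴ * γ.toBlocks₂₁).trace * contr 1 1 Y X)

/-- Its second derivative, conjugate linear in the direction `P` and linear in `Q`. -/
def devHess (k₁ k₂ k₃ : ℂ) (γ : AmbMat m n) (P Q X Y : Matrix (Fin n) (Fin m) ℂ) : ℂ :=
  k₁ * (contr (X * Yᴴ) γ.toBlocks₁₁ P Q - contr 1 (Yᴴ * γ.toBlocks₂₂ * X) P Q -
      contr (γ.toBlocks₂₂ * (X * Yᴴ)) 1 P Q - contr (X * Yᴴ * γ.toBlocks₂₂) 1 P Q) +
    k₂ * (contr γ.toBlocks₂₂ (Yᴴ * X) P Q - contr 1 (γ.toBlocks₁₁ * (Yᴴ * X)) P Q -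
      contr 1 (Yᴴ * X * γ.toBlocks₁₁) P Q - contr (X * γ.toBlocks₁₁ * Yᴴ) 1 P Q) +
    k₃ * ((contr γ.toBlocks₂₂ 1 P Q - contr 1 γ.toBlocks₁₁ P Q) * contr 1 1 Y X -
      γ.toBlocks₁₁.trace * (contr 1 (Yᴴ * X) P Q + contr (X * Yᴴ) 1 P Q))

/-- The field `k₁ h₁ + k₂ h₂ + k₃ h₃`. -/
def combination (k₁ k₂ k₃ : ℂ) (γ : AmbMat m n) : SesqField m n :=
  fun U => k₁ • h₁ γ U + k₂ • h₂ γ U + k₃ • h₃ γ U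

theorem combination_jet (k₁ k₂ k₃ : ℂ) (γ : AmbMat m n) (A : Frame m n) :
    FieldJet (combination k₁ k₂ k₃ γ) A (devValue k₁ k₂ k₃ (inFrame A γ))
      (fun P X Y => devLin k₁ k₂ k₃ (inFrame A γ) P X Y + devConj k₁ k₂ k₃ (inFrame A γ) P X Y)
      (devHess k₁ k₂ k₃ (inFrame A γ)) := fun X Y =>
  (((((h₁_jet A γ).smul k₁).add ((h₂_jet A γ).smul k₂)).add ((h₃_jet A γ).smul k₃)) X Y).congr rfl
    (fun a => by simp only [devLin, devConj]; ring) (fun a b => by simp only [devHess])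

variable (k₁ k₂ k₃ : ℂ) (γ : AmbMat m n)

theorem isSesq_devHess (X Y : Matrix (Fin n) (Fin m) ℂ) :
    IsSesq fun P Q => devHess k₁ k₂ k₃ γ P Q X Y := by
  intro c d P Q
  have e := fun t s => isSesq_contr t s c d P Q
  simp only [devHess, e]; ring

theorem isSesq_devValue : IsSesq fun Y X => devValue k₁ k₂ k₃ γ X Y := by
  intro c d P Q
  have e := fun t s => isSesq_contr t s c d P Q
  simp only [devValue, e]; ring

theorem contr_eq_trace_mul (t : Matrix (Fin n) (Fin n) ℂ) (s : Matrix (Fin m) (Fin m) ℂ)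
    (X Y : Matrix (Fin n) (Fin m) ℂ) : contr t s Y X = (s * Yᴴ * t * X).trace :=
  (trace_rotate s t X Y).symm

theorem devValue_eq_trace_mul (Y : Matrix (Fin n) (Fin m) ℂ) :
    ∃ L : Matrix (Fin m) (Fin n) ℂ, ∀ X, devValue k₁ k₂ k₃ γ X Y = (L * X).trace := by
  refine ⟨k₁ • ((1 : Matrix (Fin m) (Fin m) ℂ) * Yᴴ * γ.toBlocks₂₂) +
    k₂ • (γ.toBlocks₁₁ * Yᴴ * (1 : Matrix (Fin n) (Fin n) ℂ)) +
    k₃ • (γ.toBlocks₁₁.trace • ((1 : Matrix (Fin m) (Fin m) ℂ) * Yᴴ *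
      (1 : Matrix (Fin n) (Fin n) ℂ))), fun X => ?_⟩
  simp only [devValue, contr_eq_trace_mul, Matrix.add_mul, Matrix.trace_add, Matrix.smul_mul,
    Matrix.trace_smul, smul_eq_mul]

theorem contr_conj {t : Matrix (Fin n) (Fin n) ℂ} {s : Matrix (Fin m) (Fin m) ℂ} (ht : tᴴ = t)
    (hs : sᴴ = s) (X Y : Matrix (Fin n) (Fin m) ℂ) : conj (contr t s Y X) = contr t s X Y := by
  rw [contr_eq_trace_mul, contr, ← Complex.star_def, ← Matrix.trace_conjTranspose]
  simp only [Matrix.conjTranspose_mul, Matrix.conjTranspose_conjTranspose, ht, hs,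
    Matrix.mul_assoc]

theorem sum_contr_curv (t : Matrix (Fin n) (Fin n) ℂ) (s : Matrix (Fin m) (Fin m) ℂ)
    (X Y : Matrix (Fin n) (Fin m) ℂ) :
    ∑ I : Fin n × Fin m, contr t s (unitMat I) (unitMat I * Yᴴ * X + X * Yᴴ * unitMat I) =
      t.trace * contr 1 s Y X + s.trace * contr t 1 Y X := by
  have h : ∀ I : Fin n × Fin m, contr t s (unitMat I) (unitMat I * Yᴴ * X + X * Yᴴ * unitMat I) =
      contr t (Yᴴ * X * s) (unitMat I) (unitMat I) + contr (t * X * Yᴴ) s (unitMat I) (unitMat I) := by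
    intro I
    simp only [contr, Matrix.mul_add, Matrix.add_mul, Matrix.trace_add, Matrix.mul_assoc]
  have h2 : (t * X * Yᴴ).trace = contr t 1 Y X := by
    rw [Matrix.trace_mul_comm]; simp [contr, Matrix.mul_assoc]
  have h3 : (Yᴴ * X * s).trace = contr 1 s Y X := by simp [contr]
  simp only [h, Finset.sum_add_distrib, sum_contr, h2, h3]
  ring

/-- The contraction of the curvature with the value. -/
theorem sum_devValue_curv (X Y : Matrix (Fin n) (Fin m) ℂ) :
    ∑ I : Fin n × Fin m, devValue k₁ k₂ k₃ γ (unitMat I * Yᴴ * X + X * Yᴴ * unitMat I) (unitMat I) =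
      k₁ * (γ.toBlocks₂₂.trace * contr 1 1 Y X + m * contr γ.toBlocks₂₂ 1 Y X) +
      k₂ * (n * contr 1 γ.toBlocks₁₁ Y X + γ.toBlocks₁₁.trace * contr 1 1 Y X) +
      k₃ * (γ.toBlocks₁₁.trace * ((n + m) * contr 1 1 Y X)) := by
  simp only [devValue, Finset.sum_add_distrib, ← Finset.mul_sum, sum_contr_curv, Matrix.trace_one,
    Fintype.card_fin]
  ring

theorem trace_blocks (htr : γ.trace = 0) : γ.toBlocks₁₁.trace + γ.toBlocks₂₂.trace = 0 :=
  (Fintype.sum_sum_type fun i => γ i i).symm.trans htr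

/-- The linearized Einstein equation at the centre of a chart. It needs no relation between the
coefficients: each of `h₁`, `h₂`, `h₃` satisfies it as soon as `γ` is trace-free. -/
theorem sum_devHess (htr : γ.trace = 0) (X Y : Matrix (Fin n) (Fin m) ℂ) :
    ∑ I : Fin n × Fin m, devHess k₁ k₂ k₃ γ (unitMat I) (unitMat I) X Y =
      -(((n : ℂ) + m) * devValue k₁ k₂ k₃ γ X Y) - ∑ I : Fin n × Fin m,
        devValue k₁ k₂ k₃ γ (unitMat I * Yᴴ * X + X * Yᴴ * unitMat I) (unitMat I) := by
  have ht := trace_blocks γ htr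
  have r1 : (X * Yᴴ).trace = contr 1 1 Y X := by rw [Matrix.trace_mul_comm]; simp [contr]
  have r2 : (Yᴴ * X).trace = contr 1 1 Y X := by simp [contr]
  have r3 : (γ.toBlocks₂₂ * (X * Yᴴ)).trace = contr γ.toBlocks₂₂ 1 Y X := by
    rw [← Matrix.mul_assoc, Matrix.trace_mul_comm]; simp [contr, Matrix.mul_assoc]
  have r4 : (X * Yᴴ * γ.toBlocks₂₂).trace = contr γ.toBlocks₂₂ 1 Y X := by
    rw [Matrix.mul_assoc, Matrix.trace_mul_comm]; simp [contr]
  have r5 : (Yᴴ * γ.toBlocks₂₂ * X).trace = contr γ.toBlocks₂₂ 1 Y X := by simp [contr]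
  have r6 : (γ.toBlocks₁₁ * (Yᴴ * X)).trace = contr 1 γ.toBlocks₁₁ Y X := by
    rw [Matrix.trace_mul_comm]; simp [contr]
  have r7 : (Yᴴ * X * γ.toBlocks₁₁).trace = contr 1 γ.toBlocks₁₁ Y X := by simp [contr]
  have r8 : (X * γ.toBlocks₁₁ * Yᴴ).trace = contr 1 γ.toBlocks₁₁ Y X := by
    rw [Matrix.trace_mul_comm]; simp [contr, Matrix.mul_assoc]
  rw [sum_devValue_curv]
  simp only [devHess, devValue, Finset.sum_add_distrib, Finset.sum_sub_distrib, ← Finset.mul_sum,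
    ← Finset.sum_mul, sum_contr, r1, r2, r3, r4, r5, r6, r7, r8, Matrix.trace_one, Fintype.card_fin]
  linear_combination (k₁ + k₂ + k₃ * m) * contr 1 1 Y X * ht

theorem sum_devValue : ∑ I : Fin n × Fin m, devValue k₁ k₂ k₃ γ (unitMat I) (unitMat I) =
    k₁ * (γ.toBlocks₂₂.trace * m) + k₂ * (n * γ.toBlocks₁₁.trace) +
      k₃ * (γ.toBlocks₁₁.trace * (n * m)) := by
  simp only [devValue, Finset.sum_add_distrib, ← Finset.mul_sum, sum_contr, Matrix.trace_one,
    Fintype.card_fin]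

theorem sum_devLin (X : Matrix (Fin n) (Fin m) ℂ) :
    ∑ I : Fin n × Fin m, devLin k₁ k₂ k₃ γ (unitMat I) X (unitMat I) =
      (-(k₁ * n) + k₂ * m + k₃) * (γ.toBlocks₁₂ * X).trace := by
  have e1 : ∀ P : Matrix (Fin n) (Fin m) ℂ, (P * γ.toBlocks₁₂ * (X * Pᴴ)).trace =
      contr 1 (γ.toBlocks₁₂ * X) P P := by
    intro P
    rw [← Matrix.mul_assoc, Matrix.trace_mul_comm]; simp [contr, Matrix.mul_assoc]
  have e2 : ∀ P : Matrix (Fin n) (Fin m) ℂ, (γ.toBlocks₁₂ * P * (Pᴴ * X)).trace =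
      contr (X * γ.toBlocks₁₂) 1 P P := by
    intro P
    rw [Matrix.trace_mul_comm]; simp [contr, Matrix.mul_assoc]
  have e3 : ∀ P : Matrix (Fin n) (Fin m) ℂ, contr 1 1 P X = (Pᴴ * X).trace := by
    intro P; simp [contr]
  have e4 : ∑ I : Fin n × Fin m, (γ.toBlocks₁₂ * unitMat I).trace * ((unitMat I)ᴴ * X).trace =
      (γ.toBlocks₁₂ * X).trace := by
    rw [← sum_trace_mul_trace]
    exact Finset.sum_congr rfl fun I _ => mul_comm _ _
  simp only [devLin, e1, e2, e3, Finset.sum_add_distrib, Finset.sum_neg_distrib, ← Finset.mul_sum,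
    sum_contr, e4, Matrix.trace_one, Fintype.card_fin, Matrix.trace_mul_comm X]
  ring

theorem sum_devConj (Y : Matrix (Fin n) (Fin m) ℂ) :
    ∑ I : Fin n × Fin m, devConj k₁ k₂ k₃ γ (unitMat I) (unitMat I) Y =
      (-(k₁ * n) + k₂ * m + k₃) * (Yᴴ * γ.toBlocks₂₁).trace := by
  have e1 : ∀ P : Matrix (Fin n) (Fin m) ℂ, (Pᴴ * (P * Yᴴ * γ.toBlocks₂₁)).trace =
      contr 1 (Yᴴ * γ.toBlocks₂₁) P P := by
    intro P; simp [contr, Matrix.mul_assoc]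
  have e2 : ∀ P : Matrix (Fin n) (Fin m) ℂ, (Pᴴ * (γ.toBlocks₂₁ * (Yᴴ * P))).trace =
      contr (γ.toBlocks₂₁ * Yᴴ) 1 P P := by
    intro P; simp [contr, Matrix.mul_assoc]
  have e3 : ∀ P : Matrix (Fin n) (Fin m) ℂ, contr 1 1 Y P = (Yᴴ * P).trace := by
    intro P; simp [contr]
  simp only [devConj, e1, e2, e3, Finset.sum_add_distrib, Finset.sum_neg_distrib, ← Finset.mul_sum,
    sum_contr, sum_trace_mul_trace, Matrix.trace_one, Fintype.card_fin,
    Matrix.trace_mul_comm γ.toBlocks₂₁]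
  ring

theorem devLin_I_smul (P X Y : Matrix (Fin n) (Fin m) ℂ) :
    devLin k₁ k₂ k₃ γ (Complex.I • P) X Y = Complex.I * devLin k₁ k₂ k₃ γ P X Y := by
  simp only [devLin, Matrix.smul_mul, Matrix.mul_smul, Matrix.trace_smul, smul_eq_mul]; ring

theorem devConj_I_smul (P X Y : Matrix (Fin n) (Fin m) ℂ) :
    devConj k₁ k₂ k₃ γ (Complex.I • P) X Y = -Complex.I * devConj k₁ k₂ k₃ γ P X Y := by
  simp only [devConj, Matrix.conjTranspose_smul, Complex.star_def, Complex.conj_I, Matrix.smul_mul,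
    Matrix.trace_smul, smul_eq_mul]; ring

theorem contr_smul_right (t : Matrix (Fin n) (Fin n) ℂ) (s : Matrix (Fin m) (Fin m) ℂ) (c : ℂ)
    (P Q : Matrix (Fin n) (Fin m) ℂ) : contr t s P (c • Q) = c * contr t s P Q := by
  simpa using isSesq_contr t s 1 c P Q

theorem sum_idx_devLin_add_devConj (Y : Matrix (Fin n) (Fin m) ℂ) :
    ∑ a : Idx m n, (devLin k₁ k₂ k₃ γ (coordMat a) (coordMat a) Y +
      devConj k₁ k₂ k₃ γ (coordMat a) (coordMat a) Y) =
      2 * ((-(k₁ * n) + k₂ * m + k₃) * (Yᴴ * γ.toBlocks₂₁).trace) := by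
  have h1 := sum_idx_eq_zero (Ψ := fun P _ => devLin k₁ k₂ k₃ γ P P Y) fun P => by
    simp only [devLin, Matrix.smul_mul, Matrix.mul_smul, Matrix.trace_smul, smul_eq_mul,
      contr_smul_right]
    ring_nf
    simp only [Complex.I_sq]
    ring
  have h2 : IsSesq fun P Q => devConj k₁ k₂ k₃ γ P Q Y := by
    intro c d P Q
    simp only [devConj, Matrix.conjTranspose_smul, Complex.star_def, Matrix.smul_mul,
      Matrix.mul_smul, Matrix.trace_smul, smul_eq_mul, contr_smul_right]
    ring
  rw [Finset.sum_add_distrib, h1, h2.sum_idx, sum_devConj, zero_add]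

end Deformation

/-! ### Symmetry and positivity -/

section Hermitian

variable {U : Gr m n}

theorem sesq_conj {γ : AmbMat m n} (hγ : γ.IsHermitian) (v w : Amb m n) :
    conj (sesq γ v w) = sesq γ w v := by
  simp only [sesq, LinearMap.mk₂'ₛₗ_apply]
  rw [inner_conj_symm, inner_toEuclideanLin_left, hγ.eq]

theorem prodForm_conj {α β : AmbMat m n} (hα : α.IsHermitian) (hβ : β.IsHermitian)
    (θ η : Tang U) :
    conj (prodForm (dualForm (restr (sesq α) U.1)) (restr (sesq β) (U.1)ᗮ) θ η) =
      prodForm (dualForm (restr (sesq α) U.1)) (restr (sesq β) (U.1)ᗮ) η θ := by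
  simp only [prodForm, LinearMap.mk₂'ₛₗ_apply, dualForm, restr, map_sum, map_mul, sesq_conj hα,
    sesq_conj hβ]
  rw [Finset.sum_comm]

theorem fγ_conj {γ : AmbMat m n} (hγ : γ.IsHermitian) : conj (fγ γ U) = fγ γ U := by
  simp only [fγ, restr, LinearMap.mk₂'ₛₗ_apply, map_sum, sesq_conj hγ]

theorem combination_conj {γ : AmbMat m n} (hγ : γ.IsHermitian) (k₁ k₂ k₃ : ℝ) (θ η : Tang U) :
    conj (combination k₁ k₂ k₃ γ U θ η) = combination k₁ k₂ k₃ γ U η θ := by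
  have h1 : (1 : AmbMat m n).IsHermitian := Matrix.isHermitian_one
  simp only [combination, h₁, h₂, h₃, fubiniStudy, LinearMap.add_apply, LinearMap.smul_apply,
    smul_eq_mul, map_add, map_mul, Complex.conj_ofReal, prodForm_conj hγ h1, prodForm_conj h1 hγ,
    prodForm_conj h1 h1, fγ_conj hγ]

theorem fubiniStudy_conj (θ η : Tang U) :
    conj (fubiniStudy m n U θ η) = fubiniStudy m n U η θ :=
  prodForm_conj Matrix.isHermitian_one Matrix.isHermitian_one θ η

theorem real_symm {h : SesqField m n} (hh : ∀ U θ η, conj (h U θ η) = h U η θ) (U : Gr m n)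
    (θ η : Tang U) : h.real U θ η = h.real U η θ := by
  change 2 * (h U θ η).re = 2 * (h U η θ).re
  rw [← hh U θ η, Complex.conj_re]

theorem fubiniStudy_self (θ : Tang U) : fubiniStudy m n U θ θ =
    ∑ i, ((‖θ (stdOrthonormalBasis ℂ U.1 i)‖ ^ 2 : ℝ) : ℂ) := by
  have h1 : ∀ v w : Amb m n, sesq 1 v w = inner ℂ w v := by
    intro v w
    simp [sesq, Matrix.toLpLin_one]
  have h2 : ∀ i j, inner ℂ (stdOrthonormalBasis ℂ U.1 i : Amb m n)
      (stdOrthonormalBasis ℂ U.1 j : Amb m n) = if i = j then 1 else 0 := fun i j => by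
    simpa using orthonormal_iff_ite.1 (stdOrthonormalBasis ℂ U.1).orthonormal i j
  simp only [fubiniStudy, prodForm, LinearMap.mk₂'ₛₗ_apply, dualForm, sharp_coord, restr, h1, h2,
    ite_mul, one_mul, zero_mul, Finset.sum_ite_eq, Finset.mem_univ, if_true]
  refine Finset.sum_congr rfl fun i _ => ?_
  rw [inner_self_eq_norm_sq_to_K]
  simp

theorem fubiniStudy_pos (θ : Tang U) (hθ : θ ≠ 0) : 0 < (fubiniStudy m n).real U θ θ := by
  change 0 < 2 * (fubiniStudy m n U θ θ).re
  rw [fubiniStudy_self, ← Complex.ofReal_sum, Complex.ofReal_re]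
  have : ∃ i, θ (stdOrthonormalBasis ℂ U.1 i) ≠ 0 := by
    by_contra! hc
    exact hθ ((stdOrthonormalBasis ℂ U.1).toBasis.ext fun i => by simpa using hc i)
  obtain ⟨i, hi⟩ := this
  have : 0 < ∑ i, ‖θ (stdOrthonormalBasis ℂ U.1 i)‖ ^ 2 :=
    Finset.sum_pos' (fun _ _ => by positivity) ⟨i, Finset.mem_univ _, by positivity⟩
  linarith

theorem inFrame_isHermitian {γ : AmbMat m n} (hγ : γ.IsHermitian) (A : Frame m n) :
    (inFrame A γ).IsHermitian := by
  simp only [Matrix.IsHermitian, inFrame, Matrix.conjTranspose_mul,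
    Matrix.conjTranspose_conjTranspose, hγ.eq, Matrix.mul_assoc]

end Hermitian

/-! ### The deformation equations -/

section Main

variable {γ : AmbMat m n}

theorem fubiniStudy_isRiemannianMetric : IsRiemannianMetric (fubiniStudy m n).real where
  smooth A a b := ((fubiniStudy_jet A).real_jet a b).smooth
  symm := real_symm fun _ => fubiniStudy_conj
  pos _ := fubiniStudy_pos

/-- For Hermitian `γ` the curvature operator maps `h` to a symmetric tensor. -/
theorem sum_devValue_curv_re_comm (k₁ k₂ k₃ : ℝ) (hγ : γ.IsHermitian)
    (X Y : Matrix (Fin n) (Fin m) ℂ) :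
    (∑ I : Fin n × Fin m, devValue k₁ k₂ k₃ γ (unitMat I * Yᴴ * X + X * Yᴴ * unitMat I)
      (unitMat I)).re =
    (∑ I : Fin n × Fin m, devValue k₁ k₂ k₃ γ (unitMat I * Xᴴ * Y + Y * Xᴴ * unitMat I)
      (unitMat I)).re := by
  have ha : γ.toBlocks₁₁ᴴ = γ.toBlocks₁₁ := by ext i j; exact congrFun (congrFun hγ (.inl i)) (.inl j)
  have hd : γ.toBlocks₂₂ᴴ = γ.toBlocks₂₂ := by ext i j; exact congrFun (congrFun hγ (.inr i)) (.inr j)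
  have hta : conj γ.toBlocks₁₁.trace = γ.toBlocks₁₁.trace := by
    rw [← Complex.star_def, ← Matrix.trace_conjTranspose, ha]
  have htd : conj γ.toBlocks₂₂.trace = γ.toBlocks₂₂.trace := by
    rw [← Complex.star_def, ← Matrix.trace_conjTranspose, hd]
  rw [← Complex.conj_re, sum_devValue_curv, sum_devValue_curv]
  simp only [map_add, map_mul, Complex.conj_ofReal, hta, htd, Complex.conj_natCast,
    contr_conj hd Matrix.conjTranspose_one, contr_conj Matrix.conjTranspose_one ha,
    contr_conj (m := m) (n := n) Matrix.conjTranspose_one Matrix.conjTranspose_one]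

theorem deformation_eq (γ : AmbMat m n) : deformation γ =
    combination (((n : ℝ) * (1 - (m : ℝ) ^ 2) : ℝ) : ℂ) (((m : ℝ) * (1 - (n : ℝ) ^ 2) : ℝ) : ℂ)
      (((n : ℝ) ^ 2 - (m : ℝ) ^ 2 : ℝ) : ℂ) γ := by
  unfold deformation combination; push_cast; rfl

/-- The relation between the coefficients that makes the deformation divergence-free. -/
theorem coclosed_coeff : -((((n : ℝ) * (1 - (m : ℝ) ^ 2) : ℝ) : ℂ) * n) +
    (((m : ℝ) * (1 - (n : ℝ) ^ 2) : ℝ) : ℂ) * m + (((n : ℝ) ^ 2 - (m : ℝ) ^ 2 : ℝ) : ℂ) = 0 := by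
  push_cast; ring

/-- The coefficients also make the deformation trace-free. -/
theorem sum_devValue_deformation (htr : γ.trace = 0) : ∑ I : Fin n × Fin m,
    devValue (((n : ℝ) * (1 - (m : ℝ) ^ 2) : ℝ) : ℂ) (((m : ℝ) * (1 - (n : ℝ) ^ 2) : ℝ) : ℂ)
      (((n : ℝ) ^ 2 - (m : ℝ) ^ 2 : ℝ) : ℂ) γ (unitMat I) (unitMat I) = 0 := by
  rw [sum_devValue]
  push_cast
  linear_combination (n : ℂ) * m * (1 - (m : ℂ) ^ 2) * trace_blocks γ htr

theorem deformation_isEID (hm : 2 ≤ m) (hγ : γ.IsHermitian) (htr : γ.trace = 0) :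
    IsEID (fubiniStudy m n).real ((n : ℝ) + (m : ℝ)) (deformation γ).real := by
  rw [deformation_eq]
  have hJ := fun A => combination_jet (((n : ℝ) * (1 - (m : ℝ) ^ 2) : ℝ) : ℂ)
    (((m : ℝ) * (1 - (n : ℝ) ^ 2) : ℝ) : ℂ) (((n : ℝ) ^ 2 - (m : ℝ) ^ 2 : ℝ) : ℂ) γ A
  have htrA : ∀ A : Frame m n, (inFrame A γ).trace = 0 := fun A => by rw [trace_inFrame, htr]
  have hlam : (0 : ℝ) < (n : ℝ) + (m : ℝ) := by
    have : (2 : ℝ) ≤ m := by exact_mod_cast hm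
    positivity
  refine ⟨fubiniStudy_isRiemannianMetric, by positivity, ?_, ?_, ?_, ?_, ?_, ?_⟩
  · exact fun _ A _ b c => ricci_fubiniStudy A b c
  · exact fun A a b => ((hJ A).real_jet a b).smooth
  · exact real_symm fun _ => combination_conj hγ _ _ _
  · intro _ A _
    rw [(fubiniStudy_normalAt A).traceTensor_eq]
    simp only [((hJ A).real_jet _ _).val, ← Finset.mul_sum, ← Complex.re_sum]
    rw [(isSesq_devValue _ _ _ _).sum_idx, sum_devValue_deformation (htrA A)]
    simp
  · intro _ A _ c
    rw [(fubiniStudy_normalAt A).divTensor_eq]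
    simp only [((hJ A).real_jet _ _).fst, ← Finset.mul_sum, ← Complex.re_sum]
    rw [sum_idx_devLin_add_devConj, coclosed_coeff]
    simp
  · intro _ A _ b c
    rw [(hJ A).connLaplacian_eq (isSesq_devHess _ _ _ _),
      (hJ A).curvOp_eq (devValue_eq_trace_mul _ _ _ _) (isSesq_devValue _ _ _ _),
      sum_devHess _ _ _ _ (htrA A),
      sum_devValue_curv_re_comm _ _ _ (inFrame_isHermitian hγ A) (coordMat c) (coordMat b)]
    have h : ((n : ℂ) + m) = (((n : ℝ) + m : ℝ) : ℂ) := by push_cast; rfl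
    rw [h, Complex.sub_re, Complex.neg_re, Complex.re_ofReal_mul]
    ring

theorem deformation_isKahlerEID (htr : γ.trace = 0) :
    IsKahlerEID (fubiniStudy m n) ((n : ℝ) + (m : ℝ)) (deformation γ) := by
  rw [deformation_eq]
  have hJ := fun A => combination_jet (((n : ℝ) * (1 - (m : ℝ) ^ 2) : ℝ) : ℂ)
    (((m : ℝ) * (1 - (n : ℝ) ^ 2) : ℝ) : ℂ) (((n : ℝ) ^ 2 - (m : ℝ) ^ 2 : ℝ) : ℂ) γ A
  have htrA : ∀ A : Frame m n, (inFrame A γ).trace = 0 := fun A => by rw [trace_inFrame, htr]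
  refine ⟨?_, ?_, ?_⟩
  · intro _ A _
    rw [(fubiniStudy_kNormalAt A).lefschetzAdj_eq]
    simp only [((hJ A).form_jet _ _).val, ← Finset.mul_sum]
    rw [sum_devValue_deformation (htrA A)]
    simp
  · intro _ A _ I
    rw [(fubiniStudy_kNormalAt A).dbarStar11_eq]
    have h := fun E => dw_of_jet ((hJ A).form_jet I E)
      (p := fun P => Complex.I * devLin _ _ _ (inFrame A γ) P (unitMat I) (unitMat E))
      (r := fun P => Complex.I * devConj _ _ _ (inFrame A γ) P (unitMat I) (unitMat E))
      (fun a => mul_add _ _ _) (fun P => by rw [devLin_I_smul]) (fun P => by rw [devConj_I_smul]; ring) E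
    simp only [h, ← Finset.mul_sum]
    rw [sum_devLin, coclosed_coeff]
    simp
  · intro _ A _ I J
    rw [(hJ A).dbarLaplacian_eq (isSesq_devHess _ _ _ _) (devValue_eq_trace_mul _ _ _ _),
      sum_devHess _ _ _ _ (htrA A), ((hJ A).form_jet I J).val]
    push_cast
    ring

end Main

end GrassmannEID

end

theorem theorem3p1 (m n : ℕ) (hm : 2 ≤ m) (hn : 2 ≤ n)
    (γ : Matrix (Fin m ⊕ Fin n) (Fin m ⊕ Fin n) ℂ) (hγ : γ.IsHermitian) (htr : γ.trace = 0) :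
    GrassmannEID.IsEID (GrassmannEID.fubiniStudy m n).real ((n : ℝ) + (m : ℝ))
        (GrassmannEID.deformation γ).real ∧
      GrassmannEID.IsKahlerEID (GrassmannEID.fubiniStudy m n) ((n : ℝ) + (m : ℝ))
        (GrassmannEID.deformation γ) :=
  ⟨GrassmannEID.deformation_isEID hm hγ htr, GrassmannEID.deformation_isKahlerEID htr⟩
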